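/- Let $X\in\{A,B,C,D\}$ and let $W=W(X)=W(X_\infty)$ be the Weyl group of type $X$ of infinite rank, with simple reflections $s_1,s_2,\dots$ for $X=A$, $s_0,s_1,s_2,\dots$ for $X=B,C$ (with $(s_0s_1)^4=1$), and $s_{\hat 1},s_1,s_2,\dots$ for $X=D$ (with $(s_{\hat 1}s_2)^3=1$, $(s_{\hat 1}s_1)^2=1$). Let $\ell$ be the length function, $\le$ the Bruhat order, $m_{i,j}$ the order of $s_is_j$, and $\beta$ an indeterminate. Put $x\oplus y=x+y+\beta xy$, $\bar x=-x/(1+\beta x)$ and $x\ominus y=x\oplus\bar y$. *Grothendieck polynomials.* The algebra $\mathrm{Id}_\beta(W)$ is generated over $\mathbb Z[\beta]$ by elements $u_i$, one for each $s_i$, with the relations $u_i^2=\beta u_i$ and the braid relations $u_iu_ju_i\cdots=u_ju_iu_j\cdots$ ($m_{i,j}$ factors on each side). It has the basis $(u_w)_{w\in W}$, where $u_w=u_{i_1}\cdots u_{i_k}$ for a reduced expression $w=s_{i_1}\cdots s_{i_k}$. Let $h_i(y)=1+yu_i$ and $A^{(n)}_i(y)=h_{n-1}(y)h_{n-2}(y)\cdots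 h_i(y)$, where $y$ commutes with the $u_j$, and put $$F^B_n(y)=h_{n-1}(y)\cdots h_1(y)\,h_0(y)\,h_1(y)\cdots h_{n-1}(y),\qquad F^C_n(y)=h_{n-1}(y)\cdots h_1(y)\,h_0(y)^2\,h_1(y)\cdots h_{n-1}(y),$$ $$F^D_n(y)=h_{n-1}(y)\cdots h_2(y)\,h_1(y)h_{\hat 1}(y)\,h_2(y)\cdots h_{n-1}(y),\qquad F^A_n(y)=1,$$ $$G_{A_{n-1}}(a)=A^{(n)}_1(a_1)A^{(n)}_2(a_2)\cdots A^{(n)}_{n-1}(a_{n-1}),\qquad G^X_n(a,b;x)=G_{A_{n-1}}(\bar b)^{-1}\,F^X_n(x_1)\cdots F^X_n(x_n)\,G_{A_{n-1}}(a).$$ The double Grothendieck polynomial $\mathcal G^X_w(a,b;x)$ is the limit, as $n\to\infty$, of the coefficient of $u_w$ in $G^X_n(a,b;x)$. *Divided differences.* The operator $s^{(a)}_i$, $i\ge1$, exchanges $a_i$ and $a_{i+1}$. For $X=B,C$, $s^{(a)}_0$ maps $a_1$ to $\bar a_1$ and replaces $f(x)$ by $f(a_1,x_1,x_2,\dots)$.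 For $X=D$, $s^{(a)}_{\hat 1}$ maps $a_1$ to $\bar a_2$ and $a_2$ to $\bar a_1$ and replaces $f(x)$ by $f(a_1,a_2,x_1,x_2,\dots)$. All other variables are fixed. Let $\alpha_i(a)=a_i\ominus a_{i+1}$ for $i\ge 1$, $\alpha^B_0(a)=\bar a_1$, $\alpha^C_0(a)=\bar a_1\oplus\bar a_1$, $\alpha_{\hat 1}(a)=\bar a_1\oplus\bar a_2$, and $$\psi^{(a)}_i(f)=\frac{f-(1+\beta\alpha_i(a))\,s^{(a)}_i(f)}{\alpha_i(a)}+\beta f,\qquad \psi^{(a)}_v=\psi^{(a)}_{i_1}\cdots\psi^{(a)}_{i_k}\ \text{ for a reduced expression } v=s_{i_1}\cdots s_{i_k}.$$ The relative adjoint polynomial of $u\le w$ is $\mathcal H^X_{u,w}(a,b;x)=\psi^{(a)}_{u^{-1}w}\bigl(\mathcal G^X_w(a,b;x)\bigr)$. **Theorem 3 (change of parameter formula).** For every $w\in W(X)$, with a further sequence of variables $c=(c_1,c_2,\dots)$, $$\mathcal G^X_w(a,b;x)=\sum_{uv=w,\;u\le w}\mathcal H^X_{u,w}(\bar c,b;0)\;\mathcal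 G^X_v(a,c;x).$$ Here $(\bar c,b;0)$ means $a_i\mapsto\bar c_i$, $x_i\mapsto 0$, and $(a,c;x)$ means $b_i\mapsto c_i$. The objects are well defined: the limit defining $\mathcal G^X_w$ exists coefficientwise, all iterated divided differences of $\mathcal G^X_w$ exist (the divisions are exact), $\psi^{(a)}_v(\mathcal G^X_w)$ does not depend on the reduced expression of $v$, and the sum is finite. -/

import Mathlib

namespace KGroth

theorem end_ext {A W : Type*} [CommRing A] {f g : Module.End A (W →₀ A)}
    (h : ∀ w, f (Finsupp.single w 1) = g (Finsupp.single w 1)) : f = g := by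
  ext1 w
  ext1
  exact h w

section Coxeter

variable {I W : Type*} [Group W] {M : CoxeterMatrix I} (cs : CoxeterSystem M W)

open Classical in
/-- Auxiliary involution of `W × ZMod 2` attached to a simple reflection. -/
noncomputable def signPerm (i : I) : Function.End (W × ZMod 2) := fun p =>
  (cs.simple i * p.1 * cs.simple i, p.2 + if p.1 = cs.simple i then 1 else 0)

theorem end_mul_apply {α : Type*} (f g : Function.End α) (x : α) : (f * g) x = f (g x) := rfl

open Classical in
theorem signPerm_pow (i j : I) (k : ℕ) (p : W × ZMod 2) :
    ((signPerm cs i * signPerm cs j) ^ k) p =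
      ((cs.simple i * cs.simple j) ^ k * p.1 * ((cs.simple i * cs.simple j) ^ k)⁻¹,
        p.2 + ∑ l ∈ Finset.range (2 * k),
          if p.1 = ((cs.simple i * cs.simple j) ^ l)⁻¹ * cs.simple j then 1 else 0) := by
  have hcomm : ∀ k : ℕ, ((cs.simple i * cs.simple j) ^ k)⁻¹ * cs.simple j
      = cs.simple j * (cs.simple i * cs.simple j) ^ k := by
    intro k
    induction k with
    | zero => simp
    | succ k ih =>
      rw [pow_succ, mul_inv_rev, mul_assoc, ih, ← pow_succ, pow_succ']
      simp [mul_assoc]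
  induction k with
  | zero => simp; rfl
  | succ k ih =>
    rw [pow_succ', end_mul_apply, ih, end_mul_apply]
    set r := cs.simple i * cs.simple j with hr
    have h1 : (r ^ k * p.1 * (r ^ k)⁻¹ = cs.simple j) ↔ p.1 = (r ^ (2 * k))⁻¹ * cs.simple j := by
      have : (r ^ (2 * k))⁻¹ * cs.simple j = (r ^ k)⁻¹ * cs.simple j * r ^ k := by
        rw [two_mul, pow_add, mul_inv_rev, mul_assoc, hcomm, ← mul_assoc, hcomm]
      rw [this]
      constructor
      · intro h; rw [← h]; group
      · intro h; rw [h]; group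
    have h2 : (cs.simple j * (r ^ k * p.1 * (r ^ k)⁻¹) * cs.simple j = cs.simple i) ↔
        p.1 = (r ^ (2 * k + 1))⁻¹ * cs.simple j := by
      have : (r ^ (2 * k + 1))⁻¹ * cs.simple j
          = (r ^ k)⁻¹ * (cs.simple j * cs.simple i * cs.simple j) * r ^ k := by
        have e : 2 * k + 1 = k + 1 + k := by ring
        rw [e, pow_add, mul_inv_rev, mul_assoc, hcomm, pow_succ, hr]
        simp only [mul_assoc, ← hr, ← pow_succ', ← pow_succ]
      rw [this]
      constructor
      · intro h; rw [← h]; simp [mul_assoc]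
      · intro h; rw [h]; simp [mul_assoc]
    simp only [signPerm]
    rw [Finset.sum_congr rfl (fun _ _ => rfl), show 2 * (k + 1) = 2 * k + 1 + 1 by ring,
      Finset.sum_range_succ, Finset.sum_range_succ]
    refine Prod.ext ?_ ?_
    · simp [hr, pow_succ', mul_assoc]
    · simp only [h1, h2]
      ring

theorem signPerm_liftable : M.IsLiftable (signPerm cs) := by
  classical
  intro i j
  funext p
  rw [signPerm_pow, two_mul, Finset.sum_range_add]
  simp only [pow_add, cs.simple_mul_simple_pow, one_mul]
  have : ∀ x : ZMod 2, x + x = 0 := by decide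
  rw [this]
  simp
  rfl

/-- The homomorphism extending `signPerm`. -/
noncomputable def signHom : W →* Function.End (W × ZMod 2) :=
  cs.lift ⟨signPerm cs, signPerm_liftable cs⟩

theorem signHom_simple (i : I) : signHom cs (cs.simple i) = signPerm cs i :=
  cs.lift_apply_simple _ i

open Classical in
theorem signHom_wordProd (ω : List I) (p : W × ZMod 2) :
    signHom cs (cs.wordProd ω) p =
      (cs.wordProd ω * p.1 * (cs.wordProd ω)⁻¹, p.2 + ((cs.rightInvSeq ω).count p.1 : ℕ)) := by
  induction ω with
  | nil => simp; rfl
  | cons i ω ih =>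
    rw [cs.wordProd_cons, map_mul, end_mul_apply, ih, signHom_simple]
    have : (cs.wordProd ω * p.1 * (cs.wordProd ω)⁻¹ = cs.simple i) ↔
        ((cs.wordProd ω)⁻¹ * cs.simple i * cs.wordProd ω = p.1) := by
      constructor
      · intro h; rw [← h]; group
      · intro h; rw [← h]; group
    simp only [signPerm, CoxeterSystem.rightInvSeq, List.count_cons, this, beq_iff_eq]
    refine Prod.ext ?_ ?_
    · simp [mul_assoc]
    · push_cast; ring

theorem signHom_fst (w : W) (p : W × ZMod 2) : (signHom cs w p).1 = w * p.1 * w⁻¹ := by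
  obtain ⟨ω, -, rfl⟩ := cs.exists_isReduced w
  rw [signHom_wordProd]

theorem signHom_add (w t : W) (z z' : ZMod 2) :
    (signHom cs w (t, z + z')).2 = z + (signHom cs w (t, z')).2 := by
  obtain ⟨ω, -, rfl⟩ := cs.exists_isReduced w
  rw [signHom_wordProd, signHom_wordProd]
  ring

theorem signHom_reflection {t : W} (ht : cs.IsReflection t) (z : ZMod 2) :
    signHom cs t (t, z) = (t, z + 1) := by
  obtain ⟨u, i, rfl⟩ := ht
  set t := u * cs.simple i * u⁻¹ with ht
  have key : ∀ q, signHom cs u (signHom cs u⁻¹ q) = q := by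
    intro q
    have : (signHom cs u * signHom cs u⁻¹) q = q := by rw [← map_mul]; simp; rfl
    exact this
  have h1 : signHom cs u⁻¹ (t, z) = (cs.simple i, (signHom cs u⁻¹ (t, z)).2) := by
    refine Prod.ext ?_ rfl
    rw [signHom_fst]; simp [ht, mul_assoc]
  have h2 : signHom cs (u * cs.simple i * u⁻¹) (t, z)
      = signHom cs u (signHom cs (cs.simple i) (signHom cs u⁻¹ (t, z))) := by
    rw [map_mul, map_mul]; rfl
  rw [← ht] at h2
  rw [h2, h1, signHom_simple]
  refine Prod.ext ?_ ?_
  · rw [signHom_fst]; simp [signPerm, ht]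
  · have h3 : signPerm cs i (cs.simple i, (signHom cs u⁻¹ (t, z)).2)
        = (cs.simple i, 1 + (signHom cs u⁻¹ (t, z)).2) := by
      simp [signPerm, add_comm]
    rw [h3, signHom_add, ← h1, key]
    exact add_comm _ _

/-- The strong exchange condition. -/
theorem strong_exchange {t : W} (ht : cs.IsReflection t) (ω : List I)
    (h : cs.length (cs.wordProd ω * t) < cs.length (cs.wordProd ω)) :
    t ∈ cs.rightInvSeq ω := by
  classical
  by_contra hn
  have h0 : (cs.rightInvSeq ω).count t = 0 := List.count_eq_zero.2 hn
  obtain ⟨ω', hω', e⟩ := cs.exists_isReduced (cs.wordProd ω * t)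
  have h1 : signHom cs (cs.wordProd ω * t) (t, 0) = signHom cs (cs.wordProd ω) (t, 0 + 1) := by
    rw [map_mul, end_mul_apply, signHom_reflection cs ht]
  rw [e, signHom_wordProd, signHom_wordProd] at h1
  have h2 := congrArg Prod.snd h1
  simp only [h0] at h2
  have h3 : t ∈ cs.rightInvSeq ω' := by
    by_contra hn'
    rw [List.count_eq_zero.2 hn'] at h2
    simp at h2
  have h4 := (cs.isRightInversion_of_mem_rightInvSeq hω' h3).2
  rw [← e, mul_assoc, ht.mul_self, mul_one] at h4
  omega

theorem simple_mul_eq_mul_simple {w : W} {i j : I}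
    (h1 : cs.length w < cs.length (cs.simple i * w))
    (h2 : cs.length w < cs.length (w * cs.simple j))
    (h3 : cs.length (cs.simple i * w * cs.simple j) < cs.length (cs.simple i * w)) :
    cs.simple i * w = w * cs.simple j := by
  obtain ⟨ω, hω, rfl⟩ := cs.exists_isReduced w
  rw [← cs.wordProd_cons] at h3
  have := strong_exchange cs (cs.isReflection_simple j) _ h3
  rw [CoxeterSystem.rightInvSeq, List.mem_cons] at this
  rcases this with h | h
  · rw [h]; simp [mul_assoc]
  · have := (cs.isRightInversion_of_mem_rightInvSeq hω h).2
    omega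


open CoxeterSystem in
theorem rightInvSeq_alternatingWord (i j : I) (k : ℕ) :
    cs.rightInvSeq (alternatingWord j i k) =
      ((List.range k).map fun q => cs.simple i * (cs.simple j * cs.simple i) ^ q).reverse := by
  have hcomm : ∀ k : ℕ, ((cs.simple j * cs.simple i) ^ k)⁻¹ * cs.simple i
      = cs.simple i * (cs.simple j * cs.simple i) ^ k := by
    intro k
    induction k with
    | zero => simp
    | succ k ih =>
      rw [pow_succ, mul_inv_rev, mul_assoc, ih, ← pow_succ, pow_succ']
      simp [mul_assoc]
  induction k with
  | zero => simp [alternatingWord]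
  | succ k ih =>
    rw [alternatingWord_succ', rightInvSeq, ih, List.range_succ, List.map_append,
      List.reverse_append]
    simp only [List.map_cons, List.map_nil, List.reverse_singleton, List.singleton_append,
      List.cons.injEq, and_true]
    rw [cs.prod_alternatingWord_eq_mul_pow]
    rcases Nat.even_or_odd' k with ⟨m, rfl | rfl⟩
    · simp only [even_two_mul, if_true, one_mul]
      rw [Nat.mul_div_cancel_left _ (by norm_num), hcomm, two_mul, pow_add, mul_assoc]
    · have h1 : ¬ Even (2 * m + 1) := by simp
      have h2 : (2 * m + 1) / 2 = m := by omega
      simp only [h1, if_false, h2, mul_inv_rev, cs.inv_simple]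
      rw [hcomm, show 2 * m + 1 = m + 1 + m by ring, pow_add, pow_succ]
      simp [mul_assoc]

open CoxeterSystem in
theorem alternatingWord_nonreduced {i j : I} {k : ℕ}
    (h1 : cs.IsReduced (alternatingWord i j k)) (h2 : cs.IsReduced (alternatingWord j i k))
    (h3 : ¬ cs.IsReduced (alternatingWord i j (k + 1))) :
    cs.wordProd (alternatingWord i j k) = cs.wordProd (alternatingWord j i k) ∧
      cs.IsLeftDescent (cs.wordProd (alternatingWord i j k)) i ∧
      cs.IsLeftDescent (cs.wordProd (alternatingWord i j k)) j := by
  have hlt : cs.length (cs.wordProd (alternatingWord j i k) * cs.simple j)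
      < cs.length (cs.wordProd (alternatingWord j i k)) := by
    rw [alternatingWord_succ] at h3
    unfold CoxeterSystem.IsReduced at h2 h3
    rw [cs.wordProd_concat, List.length_concat] at h3
    rcases cs.length_mul_simple (cs.wordProd (alternatingWord j i k)) j with h | h <;> omega
  have hmem := strong_exchange cs (cs.isReflection_simple j) _ hlt
  have hnd := h2.nodup_rightInvSeq
  rw [rightInvSeq_alternatingWord] at hmem hnd
  rw [List.nodup_reverse] at hnd
  simp only [List.mem_reverse, List.mem_map, List.mem_range] at hmem
  obtain ⟨q, hq, e⟩ := hmem
  set r := cs.simple j * cs.simple i with hr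
  have hr1 : r ^ (q + 1) = 1 := by
    rw [pow_succ', hr, mul_assoc, ← hr, e]; simp
  have hqk : q + 1 = k := by
    by_contra hne
    have := List.inj_on_of_nodup_map hnd (x := q + 1) (List.mem_range.2 (by omega)) (y := 0)
      (List.mem_range.2 (by omega)) (by rw [hr1]; simp)
    omega
  rw [hqk] at hr1
  have hhead : cs.simple i * r ^ k = (cs.wordProd (alternatingWord j i k))⁻¹
      * (cs.simple (if Even k then i else j)) * cs.wordProd (alternatingWord j i k) := by
    have h := rightInvSeq_alternatingWord cs i j (k + 1)
    rw [alternatingWord_succ', rightInvSeq, List.range_succ, List.map_append,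
      List.reverse_append] at h
    simp only [List.map_cons, List.map_nil, List.reverse_singleton, List.singleton_append,
      List.cons.injEq] at h
    exact h.1.symm
  have heq : cs.wordProd (alternatingWord i j k) = cs.wordProd (alternatingWord j i k) := by
    have e1 : cs.wordProd (alternatingWord j i (k + 1))
        = cs.wordProd (alternatingWord j i k) * cs.simple i := by
      rw [alternatingWord_succ', cs.wordProd_cons]
      rw [hr1, mul_one] at hhead
      rw [hhead]
      simp [← mul_assoc]
    rw [alternatingWord_succ, cs.wordProd_concat] at e1
    exact mul_right_cancel e1
  have hdes : ∀ a b : I, cs.IsReduced (alternatingWord a b k) →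
      cs.IsLeftDescent (cs.wordProd (alternatingWord a b k)) (if Even q then b else a) := by
    intro a b hab
    rw [← hqk, alternatingWord_succ'] at hab ⊢
    have := cs.length_wordProd_le (alternatingWord a b q)
    unfold CoxeterSystem.IsReduced at hab
    unfold IsLeftDescent
    rw [hab, cs.wordProd_cons]
    simp only [List.length_cons, cs.simple_mul_simple_cancel_left]
    omega
  have d1 := hdes i j h1
  have d2 := hdes j i h2
  rw [← heq] at d2
  refine ⟨heq, ?_⟩
  by_cases hev : Even q
  · simp only [hev, if_true] at d1 d2; exact ⟨d2, d1⟩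
  · simp only [hev, if_false] at d1 d2; exact ⟨d1, d2⟩

variable {A : Type*} [CommRing A] (β : A)

/-- The operator of left multiplication by `u_i` on the free module with basis `(u_w)`:
`u_i u_w = u_{s_i w}` if `ℓ(s_i w) > ℓ(w)`, and `u_i u_w = β u_w` otherwise. -/
noncomputable def leftOp (i : I) : Module.End A (W →₀ A) :=
  Finsupp.linearCombination A fun w =>
    if cs.length w < cs.length (cs.simple i * w) then Finsupp.single (cs.simple i * w) 1
    else β • Finsupp.single w 1

/-- The operator of right multiplication by `u_i` on the free module with basis `(u_w)`. -/
noncomputable def rightOp (i : I) : Module.End A (W →₀ A) :=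
  Finsupp.linearCombination A fun w =>
    if cs.length w < cs.length (w * cs.simple i) then Finsupp.single (w * cs.simple i) 1
    else β • Finsupp.single w 1

theorem leftOp_single (i : I) (w : W) : leftOp cs β i (Finsupp.single w 1) =
    if cs.length w < cs.length (cs.simple i * w) then Finsupp.single (cs.simple i * w) 1
    else β • Finsupp.single w 1 := by
  simp [leftOp, Finsupp.linearCombination_single]

theorem rightOp_single (i : I) (w : W) : rightOp cs β i (Finsupp.single w 1) =
    if cs.length w < cs.length (w * cs.simple i) then Finsupp.single (w * cs.simple i) 1
    else β • Finsupp.single w 1 := by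
  simp [rightOp, Finsupp.linearCombination_single]

theorem leftOp_up {i : I} {w : W} (h : cs.length w < cs.length (cs.simple i * w)) :
    leftOp cs β i (Finsupp.single w 1) = Finsupp.single (cs.simple i * w) 1 := by
  rw [leftOp_single, if_pos h]

theorem leftOp_down {i : I} {w : W} (h : cs.length (cs.simple i * w) < cs.length w) :
    leftOp cs β i (Finsupp.single w 1) = β • Finsupp.single w 1 := by
  rw [leftOp_single, if_neg (by omega)]

theorem rightOp_up {i : I} {w : W} (h : cs.length w < cs.length (w * cs.simple i)) :
    rightOp cs β i (Finsupp.single w 1) = Finsupp.single (w * cs.simple i) 1 := by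
  rw [rightOp_single, if_pos h]

theorem rightOp_down {i : I} {w : W} (h : cs.length (w * cs.simple i) < cs.length w) :
    rightOp cs β i (Finsupp.single w 1) = β • Finsupp.single w 1 := by
  rw [rightOp_single, if_neg (by omega)]

theorem leftOp_sq (i : I) : leftOp (A := A) cs β i * leftOp cs β i = β • leftOp cs β i := by
  refine end_ext fun w => ?_
  rw [Module.End.mul_apply, LinearMap.smul_apply]
  rcases cs.length_simple_mul w i with h | h
  · rw [leftOp_up cs β (by omega), leftOp_down cs β (by simp; omega)]
  · rw [leftOp_down cs β (by omega), map_smul, leftOp_down cs β (by omega)]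

theorem leftOp_rightOp_comm (i j : I) :
    Commute (leftOp (A := A) cs β i) (rightOp cs β j) := by
  refine end_ext fun w => ?_
  rw [Module.End.mul_apply, Module.End.mul_apply]
  have hd := cs.length_simple_mul (w * cs.simple j) i
  have hd' := cs.length_mul_simple (cs.simple i * w) j
  have ha : cs.length (cs.simple i * (w * cs.simple j)) = cs.length (cs.simple i * w * cs.simple j) :=
    by rw [mul_assoc]
  rcases cs.length_simple_mul w i with hb | hb <;> rcases cs.length_mul_simple w j with hc | hc
  · rw [rightOp_up cs β (w := w) (by omega), leftOp_up cs β (w := w) (by omega)]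
    rcases hd with hd | hd
    · rw [leftOp_up cs β (by omega), rightOp_up cs β (by omega), mul_assoc]
    · rw [leftOp_down cs β (by omega), rightOp_down cs β (by omega),
        simple_mul_eq_mul_simple cs (i := i) (j := j) (w := w) (by omega) (by omega) (by omega)]
  · rw [rightOp_down cs β (w := w) (by omega), leftOp_up cs β (w := w) (by omega), map_smul,
      leftOp_up cs β (w := w) (by omega), rightOp_down cs β (by omega)]
  · rw [rightOp_up cs β (w := w) (by omega), leftOp_down cs β (w := w) (by omega), map_smul,
      leftOp_down cs β (by omega), rightOp_up cs β (w := w) (by omega)]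
  · rw [rightOp_down cs β (w := w) (by omega), leftOp_down cs β (w := w) (by omega), map_smul,
      map_smul, leftOp_down cs β (w := w) (by omega), rightOp_down cs β (w := w) (by omega)]

theorem end_eq_of_commute {f g : Module.End A (W →₀ A)}
    (hf : ∀ j, Commute f (rightOp cs β j)) (hg : ∀ j, Commute g (rightOp cs β j))
    (h : f (Finsupp.single 1 1) = g (Finsupp.single 1 1)) : f = g := by
  refine end_ext fun w => ?_
  induction hn : cs.length w generalizing w with
  | zero => rw [cs.length_eq_zero_iff.1 hn]; exact h
  | succ n ih =>
    obtain ⟨j, hj⟩ := cs.exists_rightDescent_of_ne_one (w := w)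
      (by rintro rfl; simp at hn)
    have hj' := cs.isRightDescent_iff.1 hj
    have e : Finsupp.single w (1 : A) = rightOp cs β j (Finsupp.single (w * cs.simple j) 1) := by
      rw [rightOp_up cs β (by simp; omega)]; simp
    have hf' := congrArg (fun T => T (Finsupp.single (w * cs.simple j) (1 : A))) (hf j).eq
    have hg' := congrArg (fun T => T (Finsupp.single (w * cs.simple j) (1 : A))) (hg j).eq
    simp only [Module.End.mul_apply] at hf' hg'
    rw [e, hf', hg', ih _ (by omega)]

/-- `u_{i_1} ⋯ u_{i_k} = u_w` for a reduced word of `w`. -/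
theorem leftOp_reduced (ω : List I) (h : cs.IsReduced ω) :
    (ω.map (leftOp cs β)).prod (Finsupp.single (1 : W) (1 : A))
      = Finsupp.single (cs.wordProd ω) 1 := by
  induction ω with
  | nil => simp
  | cons i ω ih =>
    have h' : cs.IsReduced ω := by simpa using h.drop 1
    rw [List.map_cons, List.prod_cons, Module.End.mul_apply, ih h', cs.wordProd_cons,
      leftOp_up]
    unfold CoxeterSystem.IsReduced at h h'
    rw [← cs.wordProd_cons, h, h', List.length_cons]
    omega

open CoxeterSystem in
theorem leftOp_alternating (i j : I) (k : ℕ) :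
    (cs.IsReduced (alternatingWord i j k) ∧ cs.IsReduced (alternatingWord j i k)) ∨
    ∃ v ∈ {v : W →₀ A | leftOp cs β i v = β • v ∧ leftOp cs β j v = β • v},
      ((alternatingWord i j k).map (leftOp cs β)).prod (Finsupp.single 1 1) = v ∧
      ((alternatingWord j i k).map (leftOp cs β)).prod (Finsupp.single 1 1) = v := by
  induction k with
  | zero => left; simp [alternatingWord, CoxeterSystem.IsReduced]
  | succ k ih =>
    rcases ih with ⟨h1, h2⟩ | ⟨v, ⟨hv1, hv2⟩, e1, e2⟩
    · by_cases h3 : cs.IsReduced (alternatingWord i j (k + 1)) ∧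
        cs.IsReduced (alternatingWord j i (k + 1))
      · exact Or.inl h3
      right
      have key : cs.wordProd (alternatingWord i j k) = cs.wordProd (alternatingWord j i k) ∧
          cs.IsLeftDescent (cs.wordProd (alternatingWord i j k)) i ∧
          cs.IsLeftDescent (cs.wordProd (alternatingWord i j k)) j := by
        rw [not_and_or] at h3
        rcases h3 with h3 | h3
        · exact alternatingWord_nonreduced cs h1 h2 h3
        · obtain ⟨a, b, c⟩ := alternatingWord_nonreduced cs h2 h1 h3
          rw [← a]
          exact ⟨rfl, c, b⟩
      obtain ⟨a, b, c⟩ := key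
      have b' := leftOp_down cs β b
      have c' := leftOp_down cs β c
      refine ⟨β • Finsupp.single (cs.wordProd (alternatingWord i j k)) 1, ⟨?_, ?_⟩, ?_, ?_⟩
      · rw [map_smul, b']
      · rw [map_smul, c']
      · rw [alternatingWord_succ', List.map_cons, List.prod_cons, Module.End.mul_apply,
          leftOp_reduced cs β _ h1]
        split_ifs <;> assumption
      · rw [alternatingWord_succ', List.map_cons, List.prod_cons, Module.End.mul_apply,
          leftOp_reduced cs β _ h2, ← a]
        split_ifs <;> assumption
    · right
      refine ⟨β • v, ⟨by rw [map_smul, hv1], by rw [map_smul, hv2]⟩, ?_, ?_⟩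
      · rw [alternatingWord_succ', List.map_cons, List.prod_cons, Module.End.mul_apply, e1]
        split_ifs <;> assumption
      · rw [alternatingWord_succ', List.map_cons, List.prod_cons, Module.End.mul_apply, e2]
        split_ifs <;> assumption

open CoxeterSystem in
theorem leftOp_braid (i j : I) :
    ((braidWord M i j).map (leftOp (A := A) cs β)).prod
      = ((braidWord M j i).map (leftOp cs β)).prod := by
  have hc : ∀ (ω : List I) (l : I), Commute (ω.map (leftOp (A := A) cs β)).prod (rightOp cs β l) :=
    fun ω l => Commute.list_prod_left _ _ fun x hx => by
      obtain ⟨a, -, rfl⟩ := List.mem_map.1 hx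
      exact leftOp_rightOp_comm cs β a l
  refine end_eq_of_commute cs β (hc _) (hc _) ?_
  rcases leftOp_alternating (A := A) cs β i j (M i j) with ⟨h1, h2⟩ | ⟨v, -, h1, h2⟩
  · have e := cs.wordProd_braidWord_eq i j
    unfold braidWord at e ⊢
    rw [M.symmetric j i] at e ⊢
    rw [leftOp_reduced cs β _ h1, leftOp_reduced cs β _ h2, e]
  · unfold braidWord
    rw [M.symmetric j i, h1, h2]

end Coxeter

section IdCoxeterAlgebra

variable {I W : Type*} [Group W] {M : CoxeterMatrix I} {A : Type*} [CommRing A]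

/-- The defining relations of the idCoxeter algebra: `u_i² = β u_i` and the braid relations. -/
inductive IdRel (M : CoxeterMatrix I) (β : A) : FreeAlgebra A I → FreeAlgebra A I → Prop
  | quadratic (i : I) :
      IdRel M β (FreeAlgebra.ι A i * FreeAlgebra.ι A i) (β • FreeAlgebra.ι A i)
  | braid (i j : I) :
      IdRel M β ((CoxeterSystem.braidWord M i j).map (FreeAlgebra.ι A)).prod
        ((CoxeterSystem.braidWord M j i).map (FreeAlgebra.ι A)).prod

/-- The idCoxeter algebra of a Coxeter matrix, with coefficients in a commutative ring `A` and
parameter `β ∈ A`: generators `u_i` and the relations `IdRel`. -/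
abbrev IdCoxeter (M : CoxeterMatrix I) (β : A) : Type _ := RingQuot (IdRel M β)

/-- The generator `u_i`. -/
noncomputable def u (M : CoxeterMatrix I) (β : A) (i : I) : IdCoxeter M β :=
  RingQuot.mkAlgHom A (IdRel M β) (FreeAlgebra.ι A i)

/-- The left regular representation of the idCoxeter algebra, written on the basis `(u_w)`. -/
noncomputable def regularRep (cs : CoxeterSystem M W) (β : A) :
    IdCoxeter M β →ₐ[A] Module.End A (W →₀ A) :=
  RingQuot.liftAlgHom A ⟨FreeAlgebra.lift A (leftOp cs β), by
    intro x y h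
    induction h with
    | quadratic i => simpa using leftOp_sq cs β i
    | braid i j =>
      have := leftOp_braid (A := A) cs β i j
      simpa [map_list_prod, List.map_map, Function.comp_def] using this⟩

theorem regularRep_u (cs : CoxeterSystem M W) (β : A) (i : I) :
    regularRep cs β (u M β i) = leftOp cs β i := by
  simp [regularRep, u]

/-- The coefficient of `u_w` in an element `y` of the idCoxeter algebra, that is, the coordinate
at `u_w` of `y · 1`. -/
noncomputable def coeffU (cs : CoxeterSystem M W) (β : A) (w : W) (y : IdCoxeter M β) : A :=
  regularRep cs β y (Finsupp.single 1 1) w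

open Classical in
/-- For `u_v := u_{i_1} ⋯ u_{i_k}` with `(i_1, …, i_k)` a reduced word of `v`, the coefficient of
`u_w` in `u_v` is `1` if `w = v` and `0` otherwise. -/
theorem coeffU_reduced (cs : CoxeterSystem M W) (β : A) (ω : List I) (h : cs.IsReduced ω) (w : W) :
    coeffU cs β w (ω.map (u M β)).prod = if cs.wordProd ω = w then 1 else 0 := by
  have e : regularRep cs β (ω.map (u M β)).prod = (ω.map (leftOp cs β)).prod := by
    rw [map_list_prod, List.map_map]
    congr 1
    exact List.map_congr_left fun i _ => regularRep_u cs β i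
  rw [coeffU, e, leftOp_reduced cs β ω h, Finsupp.single_apply]

/-- The Bruhat order: `v ≤ w` if there is a chain from `v` to `w` in which every step multiplies
by a reflection and increases the length. -/
def BruhatLE (cs : CoxeterSystem M W) : W → W → Prop :=
  Relation.ReflTransGen fun x y => ∃ t, cs.IsReflection t ∧ y = x * t ∧ cs.length x < cs.length y

end IdCoxeterAlgebra

/-! ### Types and Weyl groups of infinite rank -/

/-- The four classical types. -/
inductive ClassicalType
  | A | B | C | D

/-- The name of the `j`-th node of the Dynkin diagram of type `X_∞`, `j = 0, 1, 2, …`.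
In type `A` the simple reflections are `s_1, s_2, …`; in types `B` and `C` they are
`s_0, s_1, s_2, …`; in type `D` they are `s_{1̂}, s_1, s_2, …`, and `1̂` has the name `0`. -/
def label : ClassicalType → ℕ → ℕ
  | .A, j => j + 1
  | _, j => j

/-- The node with a given name. -/
def node : ClassicalType → ℕ → ℕ
  | .A, i => i - 1
  | _, i => i

/-- The order `m_{i,j}` of `s_i s_j` for two nodes `i < j`. -/
def bond : ClassicalType → ℕ → ℕ → ℕ
  | .A, i, j => if j = i + 1 then 3 else 2
  | .B, i, j => if j = i + 1 then (if i = 0 then 4 else 3) else 2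
  | .C, i, j => if j = i + 1 then (if i = 0 then 4 else 3) else 2
  | .D, i, j => if i = 0 then (if j = 2 then 3 else 2) else (if j = i + 1 then 3 else 2)

theorem bond_ne_one (X : ClassicalType) (i j : ℕ) : bond X i j ≠ 1 := by
  cases X <;> simp only [bond] <;> split_ifs <;> norm_num

/-- The Coxeter matrix of type `X_∞`. -/
def coxeterMatrix (X : ClassicalType) : CoxeterMatrix ℕ where
  M := Matrix.of fun i j => if i = j then 1 else bond X (min i j) (max i j)
  isSymm := by
    ext i j
    simp only [Matrix.transpose_apply, Matrix.of_apply, eq_comm (a := j), min_comm j, max_comm j]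
  diagonal := by simp
  off_diagonal i j h := by simpa [h] using bond_ne_one X _ _

/-- The Weyl group `W(X) = W(X_∞)`. -/
abbrev Weyl (X : ClassicalType) : Type := (coxeterMatrix X).Group

/-- `W(X)` with its simple reflections. -/
def weylSystem (X : ClassicalType) : CoxeterSystem (coxeterMatrix X) (Weyl X) :=
  (coxeterMatrix X).toCoxeterSystem

/-! ### The ring of coefficients -/

/-- The variables `a_i, b_i, c_i, x_i`, `i ≥ 1` (the ones with index `0` are not used). -/
inductive Var
  | a (i : ℕ) | b (i : ℕ) | c (i : ℕ) | x (i : ℕ)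

/-- The ring `ℤ[β][[a, b, c, x]]` of formal power series in the infinitely many variables `Var`.
It contains the `β`-supersymmetric functions in `x` with coefficients in
`ℤ[β][a, ā, b, b̄, c, c̄]`. -/
abbrev Ser : Type := MvPowerSeries Var (Polynomial ℤ)

/-- The indeterminate `β`. -/
noncomputable def beta : Ser := MvPowerSeries.C Polynomial.X

/-- The variables `a_i` as a sequence of power series. -/
noncomputable def va (i : ℕ) : Ser := MvPowerSeries.X (Var.a i)

/-- The variables `b_i` as a sequence of power series. -/
noncomputable def vb (i : ℕ) : Ser := MvPowerSeries.X (Var.b i)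

/-- The variables `c_i` as a sequence of power series. -/
noncomputable def vc (i : ℕ) : Ser := MvPowerSeries.X (Var.c i)

/-- The variables `x_i` as a sequence of power series. -/
noncomputable def vx (i : ℕ) : Ser := MvPowerSeries.X (Var.x i)

/-- `f ⊕ g = f + g + β f g`. -/
noncomputable def oplus (f g : Ser) : Ser := f + g + beta * f * g

/-- `f̄ = ⊖ f = - f / (1 + β f)`, for `f` without constant term. -/
noncomputable def bar (f : Ser) : Ser := -(f * MvPowerSeries.invOfUnit (1 + beta * f) 1)

/-- `f(p, q; y)` for `f = f(a, b; x)`: the result of the substitution `a_i ↦ p_i`, `b_i ↦ q_i`,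
`x_i ↦ y_i` for all `i`. -/
noncomputable def evalAt (p q y : ℕ → Ser) (f : Ser) : Ser :=
  MvPowerSeries.subst (fun
    | .a i => p i
    | .b i => q i
    | .c i => vc i
    | .x i => y i : Var → Ser) f

/-! ### Divided difference operators -/

/-- The images of the variables under `s_i^{(a)}` (`i` is the name of the simple reflection).
It exchanges `a_i` and `a_{i+1}` for `i ≥ 1`. For `i = 0` in types `B`, `C` it maps `a_1 ↦ ā_1` and
`f(x) ↦ f(a_1, x_1, x_2, …)`; for `i = 1̂` in type `D` it maps `a_1 ↦ ā_2`, `a_2 ↦ ā_1` and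
`f(x) ↦ f(a_1, a_2, x_1, x_2, …)`. -/
noncomputable def reflVar : ClassicalType → ℕ → Var → Ser
  | _, i + 1, .a k => va (Equiv.swap (i + 1) (i + 2) k)
  | .D, 0, .a 1 => bar (va 2)
  | .D, 0, .a 2 => bar (va 1)
  | .D, 0, .x 1 => va 1
  | .D, 0, .x 2 => va 2
  | .D, 0, .x (k + 3) => vx (k + 1)
  | .B, 0, .a 1 => bar (va 1)
  | .B, 0, .x 1 => va 1
  | .B, 0, .x (k + 2) => vx (k + 1)
  | .C, 0, .a 1 => bar (va 1)
  | .C, 0, .x 1 => va 1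
  | .C, 0, .x (k + 2) => vx (k + 1)
  | _, _, t => MvPowerSeries.X t

/-- The action of `s_i^{(a)}`. -/
noncomputable def refl (X : ClassicalType) (i : ℕ) (f : Ser) : Ser :=
  MvPowerSeries.subst (reflVar X i) f

/-- The element `α_i(a)` of the simple root `α_i` (`i` is the name of the simple reflection):
`a_i ⊕ ā_{i+1}` for `i ≥ 1`; `ā_1` in type `B`, `ā_1 ⊕ ā_1` in type `C` for `i = 0`; and
`ā_1 ⊕ ā_2` in type `D` for `i = 1̂`. -/
noncomputable def root : ClassicalType → ℕ → Ser
  | _, i + 1 => oplus (va (i + 1)) (bar (va (i + 2)))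
  | .B, 0 => bar (va 1)
  | .C, 0 => oplus (bar (va 1)) (bar (va 1))
  | .D, 0 => oplus (bar (va 1)) (bar (va 2))
  | .A, 0 => 1

open Classical in
/-- The quotient `f / g` when `g` divides `f`. -/
noncomputable def exactQuotient (f g : Ser) : Ser := if h : g ∣ f then h.choose else 0

/-- The numerator `f - (1 + β α_i(a)) s_i^{(a)} f` of the divided difference at the node `j`. -/
noncomputable def piNumerator (X : ClassicalType) (j : ℕ) (f : Ser) : Ser :=
  f - (1 + beta * root X (label X j)) * refl X (label X j) f

/-- The divided difference operator `π_i^{(a)}` at the node `j`. -/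
noncomputable def piOp (X : ClassicalType) (j : ℕ) (f : Ser) : Ser :=
  exactQuotient (piNumerator X j f) (root X (label X j))

/-- The divided difference operator `ψ_i^{(a)} = π_i^{(a)} + β` at the node `j`. -/
noncomputable def psiOp (X : ClassicalType) (j : ℕ) (f : Ser) : Ser := piOp X j f + beta * f

/-- The composition `ψ_{i_1} ∘ ⋯ ∘ ψ_{i_k}` along a word of nodes. -/
noncomputable def psiWord (X : ClassicalType) (ω : List ℕ) (f : Ser) : Ser :=
  ω.foldr (psiOp X) f

/-- The operator `ψ_v^{(a)}`: the composition of the `ψ_i^{(a)}` along a reduced word of `v`. -/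
noncomputable def psi (X : ClassicalType) (v : Weyl X) (f : Ser) : Ser :=
  psiWord X ((weylSystem X).exists_isReduced v).choose f

/-! ### Double Grothendieck polynomials -/

/-- The idCoxeter algebra of `W(X)` over the ring `Ser`. -/
abbrev IdAlg (X : ClassicalType) : Type := IdCoxeter (coxeterMatrix X) beta

/-- `h_i(y) = 1 + y u_i`, where `i` is the name of a simple reflection. -/
noncomputable def h (X : ClassicalType) (i : ℕ) (y : Ser) : IdAlg X :=
  1 + y • u (coxeterMatrix X) beta (node X i)

/-- `h_i(y) h_{i+1}(y) ⋯ h_{n-1}(y)`. -/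
noncomputable def ascProd (X : ClassicalType) (n i : ℕ) (y : Ser) : IdAlg X :=
  ((List.range' i (n - i)).map fun k => h X k y).prod

/-- `A_i^{(n)}(y) = h_{n-1}(y) h_{n-2}(y) ⋯ h_i(y)`. -/
noncomputable def descProd (X : ClassicalType) (n i : ℕ) (y : Ser) : IdAlg X :=
  ((List.range' i (n - i)).reverse.map fun k => h X k y).prod

/-- `F_n^X(y)` for `X = B, C, D`; in type `A` there is no such factor. -/
noncomputable def F : (X : ClassicalType) → ℕ → Ser → IdAlg X
  | .A, _, _ => 1
  | .B, n, y => descProd .B n 1 y * h .B 0 y * ascProd .B n 1 y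
  | .C, n, y => descProd .C n 1 y * h .C 0 y ^ 2 * ascProd .C n 1 y
  | .D, n, y => descProd .D n 2 y * (h .D 1 y * h .D 0 y) * ascProd .D n 2 y

/-- `F_n^X(x_1, …, x_n) = F_n^X(x_1) ⋯ F_n^X(x_n)`. -/
noncomputable def boldF (X : ClassicalType) (n : ℕ) : IdAlg X :=
  ((List.range' 1 n).map fun i => F X n (vx i)).prod

/-- `G_{A_{n-1}}(p_1, …, p_{n-1}) = A_1^{(n)}(p_1) A_2^{(n)}(p_2) ⋯ A_{n-1}^{(n)}(p_{n-1})`. -/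
noncomputable def GA (X : ClassicalType) (n : ℕ) (p : ℕ → Ser) : IdAlg X :=
  ((List.range' 1 (n - 1)).map fun i => descProd X n i (p i)).prod

/-- `G_n^X(a, b; x) = G_{A_{n-1}}(b̄_1, …, b̄_{n-1})⁻¹ F_n^X(x) G_{A_{n-1}}(a_1, …, a_{n-1})`. -/
noncomputable def G (X : ClassicalType) (n : ℕ) : IdAlg X :=
  Ring.inverse (GA X n fun i => bar (vb i)) * boldF X n * GA X n va

/-- `𝒢_{n,w}^X(a, b; x)`, the coefficient of `u_w` in `G_n^X(a, b; x)`. -/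
noncomputable def grothN (X : ClassicalType) (n : ℕ) (w : Weyl X) : Ser :=
  coeffU (weylSystem X) beta w (G X n)

/-- `f` is the limit of the sequence `f_n`: the coefficient of every monomial in `f_n` is equal to
the one in `f` for all large `n`. -/
def IsLimit (fs : ℕ → Ser) (f : Ser) : Prop :=
  ∀ d : Var →₀ ℕ, ∀ᶠ n in Filter.atTop, MvPowerSeries.coeff d (fs n) = MvPowerSeries.coeff d f

open Classical in
/-- The double Grothendieck polynomial `𝒢_w^X(a, b; x)`, the coefficient of `u_w` in
`lim_n G_n^X(a, b; x)`. -/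
noncomputable def groth (X : ClassicalType) (w : Weyl X) : Ser :=
  if h : ∃ f, IsLimit (fun n => grothN X n w) f then h.choose else 0

/-- The relative adjoint polynomial `ℋ_{v,w}^X(a, b; x) = ψ_{v⁻¹w}^{(a)}(𝒢_w^X(a, b; x))`. -/
noncomputable def relAdjoint (X : ClassicalType) (v w : Weyl X) : Ser :=
  psi X (v⁻¹ * w) (groth X w)

end KGroth

/-!
Write `𝒢 = ∑ 𝒢_w u_w` for the limit of the products `G_n^X(a, b; x)`. The theorem rests on two
facts.

*The operators `ψ_i` are right multiplications by `u_i`.* The reflection `s_i^{(a)}` turns `𝒢`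
into `𝒢 · h_i(ᾱ_i(a))` (`reflHom_groth`), and `(1 + β α) ᾱ = - α`; so `α_i(a)` divides the
numerator of the divided difference and `ψ_i(𝒢_w)` is the coefficient of `u_w` in `𝒢 u_i`. By
iteration, `ψ_v(𝒢_w)` is the coefficient of `u_w` in `𝒢 u_v` (`psiWord_groth`), whatever the
reduced word of `v`. The identity for `s_i^{(a)}` comes from the Yang–Baxter equations. For
`i ≥ 1` it is an exchange rule for neighbouring factors of `G_{A_{n-1}}(a)`
(`IsTypeA.desc_exchange`). For the special reflection, the new variables prepended to `x` produce
factors `F(a_1)` (or `F(a_1) F(a_2)`). These can be moved next to `G_{A_{n-1}}`, because the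
elements `F_n^X(y)` commute (`genF_commute`), and there they cancel against the changed factors of
`G_{A_{n-1}}`. The commutation of the `F_n^X(y)` follows from a reflection equation which
propagates from `n` to `n + 1` (`IsTypeA.reflection_step`).

*Multiplicativity.* `G_n^X(a, b; x) = G_n^X(c̄, b; 0) G_n^X(a, c; x)` (`doubleG_eq_mul`). The
coefficient of `u_w` in this product is the sum over `v` of the coefficient of `u_w` in
`G_n^X(c̄, b; 0) u_v`, which is the specialization of `ψ_v(𝒢_w)`, times the coefficient of `u_v`
in `G_n^X(a, c; x)` (`coeffU_mul`). The first coefficient vanishes unless `w v⁻¹ ≤ w`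
(`bruhatLE_of_rightMulWord_ne_zero`), and Bruhat intervals are finite (`bruhatLE_finite`).

The limits are controlled by parabolic subgroups: if `w` is a product of simple reflections with
names less than `m`, the other generators do not affect the coefficient of `u_w`, so `n` can be
replaced by `m` (`coeffU_genG_truncate`). Only the number of the variables `x` then grows, and the
factor `F_m^X(x_N)` is congruent to `1` modulo `x_N` (`isLimit_doubleG`).
-/

namespace KGroth

/-! ### Yang–Baxter equations -/

section YangBaxter

variable {A H : Type*} [CommRing A] [Ring H] [Algebra A H] {β : A}

/-- The factor `1 + y u` of the generating products, for a general element `u` of an algebra. -/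
def factor (u : H) (y : A) : H := 1 + y • u

theorem factor_zero (u : H) : factor u (0 : A) = 1 := by simp [factor]

theorem factor_mul_factor {u : H} (hu : u * u = β • u) (x y : A) :
    factor u x * factor u y = factor u (x + y + β * x * y) := by
  simp only [factor, mul_add, add_mul, one_mul, mul_one, smul_mul_assoc, mul_smul_comm, hu]
  module

theorem factor_commute {u v : H} (h : Commute u v) (x y : A) :
    Commute (factor u x) (factor v y) := by
  unfold factor
  exact (Commute.one_left _).add_left
    ((Commute.one_right _).add_right ((h.smul_left x).smul_right y))

/-- The Yang–Baxter equation for a bond of order three. -/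
theorem yangBaxter_three {u v : H} (hu : u * u = β • u) (hv : v * v = β • v)
    (huv : u * v * u = v * u * v) {x y q : A} (hq : q = x + y + β * x * y) :
    factor u x * factor v q * factor u y = factor v y * factor u q * factor v x := by
  subst hq
  simp only [factor, mul_add, add_mul, one_mul, mul_one, smul_mul_assoc, mul_smul_comm, hu, hv, huv]
  module

/-- The Yang–Baxter equation for a bond of order four. In type `B` one has `f y = y`, and in type
`C` one has `f y = y ⊕ y`. -/
theorem yangBaxter_four {u v : H} (hu : u * u = β • u) (hv : v * v = β • v)
    (huv : u * v * u * v = v * u * v * u) {x y p q x' y' : A}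
    (hx : x = p + y + β * p * y) (hq : q = x + y + β * x * y)
    (h : x' = x ∧ y' = y ∨ x' = x + x + β * x * x ∧ y' = y + y + β * y * y) :
    factor v p * factor u x' * factor v q * factor u y' =
      factor u y' * factor v q * factor u x' * factor v p := by
  have hu' : ∀ z, z * u * u = β • (z * u) := fun z => by rw [mul_assoc, hu, mul_smul_comm]
  have hv' : ∀ z, z * v * v = β • (z * v) := fun z => by rw [mul_assoc, hv, mul_smul_comm]
  rcases h with ⟨rfl, rfl⟩ | ⟨rfl, rfl⟩
  all_goals
    simp only [factor, mul_add, add_mul, one_mul, mul_one, smul_mul_assoc, mul_smul_comm, hu, hv,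
      hu', hv', huv]
    subst hq hx
    module

end YangBaxter

/-! ### Descending and ascending products -/

section Products

variable {A H : Type*} [CommRing A] [Ring H] [Algebra A H] {β : A}

/-- The product `(1 + y g_{n-1}) ⋯ (1 + y g_i)`. -/
def desc (g : ℕ → H) (n i : ℕ) (y : A) : H :=
  ((List.range' i (n - i)).reverse.map fun k => factor (g k) y).prod

/-- The product `(1 + y g_i) ⋯ (1 + y g_{n-1})`. -/
def asc (g : ℕ → H) (n i : ℕ) (y : A) : H :=
  ((List.range' i (n - i)).map fun k => factor (g k) y).prod

theorem range'_bot {n i : ℕ} (h : i < n) :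
    List.range' i (n - i) = i :: List.range' (i + 1) (n - (i + 1)) := by
  rw [show n - i = n - (i + 1) + 1 by omega, List.range'_succ]

theorem range'_top {n i : ℕ} (h : i ≤ n) :
    List.range' i (n + 1 - i) = List.range' i (n - i) ++ [n] := by
  rw [show n + 1 - i = n - i + 1 by omega, List.range'_concat]
  simp; omega

theorem desc_self (g : ℕ → H) (n i : ℕ) (h : n ≤ i) (y : A) : desc g n i y = 1 := by
  simp [desc, Nat.sub_eq_zero_of_le h]

theorem asc_self (g : ℕ → H) (n i : ℕ) (h : n ≤ i) (y : A) : asc g n i y = 1 := by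
  simp [asc, Nat.sub_eq_zero_of_le h]

theorem desc_bot (g : ℕ → H) {n i : ℕ} (h : i < n) (y : A) :
    desc g n i y = desc g n (i + 1) y * factor (g i) y := by
  simp [desc, range'_bot h]

theorem asc_bot (g : ℕ → H) {n i : ℕ} (h : i < n) (y : A) :
    asc g n i y = factor (g i) y * asc g n (i + 1) y := by
  simp [asc, range'_bot h]

theorem desc_top (g : ℕ → H) {n i : ℕ} (h : i ≤ n) (y : A) :
    desc g (n + 1) i y = factor (g n) y * desc g n i y := by
  simp [desc, range'_top h]

theorem asc_top (g : ℕ → H) {n i : ℕ} (h : i ≤ n) (y : A) :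
    asc g (n + 1) i y = asc g n i y * factor (g n) y := by
  simp [asc, range'_top h]

theorem desc_zero (g : ℕ → H) (n i : ℕ) : desc g n i (0 : A) = 1 := by
  refine List.prod_eq_one fun x hx => ?_
  obtain ⟨k, -, rfl⟩ := List.mem_map.1 hx
  exact factor_zero _

theorem asc_zero (g : ℕ → H) (n i : ℕ) : asc g n i (0 : A) = 1 := by
  refine List.prod_eq_one fun x hx => ?_
  obtain ⟨k, -, rfl⟩ := List.mem_map.1 hx
  exact factor_zero _

theorem commute_desc {g : ℕ → H} {z : H} {i : ℕ} (hz : ∀ k ≥ i, Commute z (g k)) (n : ℕ) (y : A) :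
    Commute z (desc g n i y) := by
  refine Commute.list_prod_right _ _ fun x hx => ?_
  obtain ⟨k, hk, rfl⟩ := List.mem_map.1 hx
  rw [List.mem_reverse, List.mem_range'_1] at hk
  exact (Commute.one_right _).add_right ((hz k hk.1).smul_right y)

theorem desc_congr {g g' : ℕ → H} {i : ℕ} (h : ∀ k ≥ i, g k = g' k) (n : ℕ) (y : A) :
    desc g n i y = desc g' n i y := by
  unfold desc
  congr 1
  refine List.map_congr_left fun k hk => ?_
  rw [List.mem_reverse, List.mem_range'_1] at hk
  rw [h k hk.1]

/-- The relations of the idCoxeter algebra of type `A_∞` between `g_1, g_2, …`. -/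
structure IsTypeA (β : A) (g : ℕ → H) : Prop where
  sq : ∀ k ≥ 1, g k * g k = β • g k
  comm : ∀ k ≥ 1, ∀ l ≥ k + 2, Commute (g k) (g l)
  braid : ∀ k ≥ 1, g k * g (k + 1) * g k = g (k + 1) * g k * g (k + 1)

namespace IsTypeA

variable {g : ℕ → H}

theorem factor_mul (hg : IsTypeA β g) {k : ℕ} (hk : 1 ≤ k) {x y z : A} (h : z = x + y + β * x * y) :
    factor (g k) x * factor (g k) y = factor (g k) z := by
  rw [factor_mul_factor (hg.sq k hk), h]

theorem desc_mul_asc (hg : IsTypeA β g) {x y : A} (h : x + y + β * x * y = 0) (n : ℕ) {i : ℕ}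
    (hi : 1 ≤ i) : desc g n i x * asc g n i y = 1 := by
  induction hd : n - i generalizing i with
  | zero => rw [desc_self _ _ _ (by omega), asc_self _ _ _ (by omega), one_mul]
  | succ d ih =>
    rw [desc_bot _ (by omega), asc_bot _ (by omega), mul_assoc, ← mul_assoc (factor _ _),
      hg.factor_mul hi h.symm, factor_zero, one_mul, ih (by omega) (by omega)]

theorem asc_mul_desc (hg : IsTypeA β g) {x y : A} (h : x + y + β * x * y = 0) (n : ℕ) {i : ℕ}
    (hi : 1 ≤ i) : asc g n i x * desc g n i y = 1 := by
  rcases le_total n i with hn | hn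
  · rw [desc_self _ _ _ hn, asc_self _ _ _ hn, one_mul]
  induction n, hn using Nat.le_induction with
  | base => rw [desc_self _ _ _ le_rfl, asc_self _ _ _ le_rfl, one_mul]
  | succ n hn ih =>
    rw [desc_top _ hn, asc_top _ hn, mul_assoc, ← mul_assoc (factor _ _),
      hg.factor_mul (by omega) h.symm, factor_zero, one_mul, ih]

/-- The exchange rule behind the action of a divided difference on the parameters `a`:
`A_i(x) A_{i+1}(y) h_i(y ⊖ x) = A_i(y) A_{i+1}(x)`. -/
theorem desc_exchange (hg : IsTypeA β g) {x y p : A} (hy : y = x + p + β * x * p) {n i : ℕ}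
    (hi : 1 ≤ i) (hn : i < n) :
    desc g n i x * desc g n (i + 1) y * factor (g i) p = desc g n i y * desc g n (i + 1) x := by
  induction hd : n - (i + 1) generalizing i with
  | zero =>
    rw [desc_bot _ hn, desc_bot _ hn]
    rw [desc_self _ _ (i + 1) (by omega), desc_self _ _ (i + 1) (by omega)]
    simp [hg.factor_mul hi hy]
  | succ d ih =>
    have hc : ∀ z w : A, Commute (factor (g i) w) (desc g n (i + 2) z) := fun z w =>
      commute_desc (fun k hk => by
        have := (hg.comm i hi k hk).smul_left w
        exact (Commute.one_left _).add_left this) n z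
    have yb := yangBaxter_three (hg.sq i hi) (hg.sq (i + 1) (by omega)) (hg.braid i hi)
      (x := x) (y := p) (q := y) hy
    have ih := ih (i := i + 1) (by omega) (by omega) (by omega)
    calc desc g n i x * desc g n (i + 1) y * factor (g i) p
        = desc g n (i + 1) x * (factor (g i) x * desc g n (i + 2) y)
            * factor (g (i + 1)) y * factor (g i) p := by
          rw [desc_bot _ hn, desc_bot g (i := i + 1) (y := y) (by omega)]
          simp only [mul_assoc]
      _ = desc g n (i + 1) x * desc g n (i + 2) y
            * (factor (g i) x * factor (g (i + 1)) y * factor (g i) p) := by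
          rw [(hc y x).eq]; simp only [mul_assoc]
      _ = (desc g n (i + 1) x * desc g n (i + 2) y * factor (g (i + 1)) p) * factor (g i) y
            * factor (g (i + 1)) x := by
          rw [yb]; simp only [mul_assoc]
      _ = desc g n (i + 1) y * (desc g n (i + 2) x * factor (g i) y) * factor (g (i + 1)) x := by
          rw [ih]; simp only [mul_assoc]
      _ = _ := by
          rw [← (hc x y).eq, desc_bot g hn, desc_bot g (i := i + 1) (y := x) (by omega)]
          simp only [mul_assoc]

/-- The reflection equation is inherited under `K(y) ↦ h_n(y) K(y) h_n(y)`, and it implies that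
the elements `h_n(y) K(y) h_n(y)` commute. -/
theorem reflection_step (hg : IsTypeA β g) {n : ℕ} (hn : 1 ≤ n) {x y p q : A} {Kx Ky : H}
    (hx : x = p + y + β * p * y) (hq : q = x + y + β * x * y)
    (hKx : Commute Kx (g (n + 1))) (hKy : Commute Ky (g (n + 1)))
    (hK : factor (g n) p * Kx * factor (g n) q * Ky = Ky * factor (g n) q * Kx * factor (g n) p) :
    factor (g (n + 1)) p * (factor (g n) x * Kx * factor (g n) x) * factor (g (n + 1)) q
        * (factor (g n) y * Ky * factor (g n) y)
      = (factor (g n) y * Ky * factor (g n) y) * factor (g (n + 1)) q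
        * (factor (g n) x * Kx * factor (g n) x) * factor (g (n + 1)) p := by
  have hc : ∀ {K : H}, Commute K (g (n + 1)) → ∀ z : A, K * factor (g (n + 1)) z
      = factor (g (n + 1)) z * K := fun h z =>
    ((Commute.one_right _).add_right (h.smul_right z)).eq
  have yb := fun {x y q : A} (h : q = x + y + β * x * y) =>
    yangBaxter_three (hg.sq n hn) (hg.sq (n + 1) (by omega)) (hg.braid n hn) h
  have hx' : x = y + p + β * y * p := by rw [hx]; ring
  calc _ = factor (g (n + 1)) p * factor (g n) x * Kx
            * (factor (g n) x * factor (g (n + 1)) q * factor (g n) y) * Ky * factor (g n) y := by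
          simp only [mul_assoc]
    _ = factor (g (n + 1)) p * factor (g n) x * (Kx * factor (g (n + 1)) y)
          * factor (g n) q * (factor (g (n + 1)) x * Ky) * factor (g n) y := by
          rw [yb hq]; simp only [mul_assoc]
    _ = (factor (g (n + 1)) p * factor (g n) x * factor (g (n + 1)) y) * Kx
          * factor (g n) q * Ky * factor (g (n + 1)) x * factor (g n) y := by
          rw [hc hKx, ← hc hKy]; simp only [mul_assoc]
    _ = factor (g n) y * factor (g (n + 1)) x * (factor (g n) p * Kx
          * factor (g n) q * Ky) * factor (g (n + 1)) x * factor (g n) y := by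
          rw [← yb hx']; simp only [mul_assoc]
    _ = factor (g n) y * factor (g (n + 1)) x * Ky * factor (g n) q * Kx
          * (factor (g n) p * factor (g (n + 1)) x * factor (g n) y) := by
          rw [hK]; simp only [mul_assoc]
    _ = factor (g n) y * (factor (g (n + 1)) x * Ky) * factor (g n) q * (Kx
          * factor (g (n + 1)) y) * factor (g n) x * factor (g (n + 1)) p := by
          rw [yb hx]; simp only [mul_assoc]
    _ = factor (g n) y * Ky * (factor (g (n + 1)) x * factor (g n) q * factor (g (n + 1)) y)
          * Kx * factor (g n) x * factor (g (n + 1)) p := by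
          rw [hc hKx, ← hc hKy]; simp only [mul_assoc]
    _ = _ := by
          rw [← yb (x := y) (y := x) (by rw [hq]; ring)]; simp only [mul_assoc]

theorem commute_of_reflection (hg : IsTypeA β g) {n : ℕ} (hn : 1 ≤ n) {x y p q : A} {Kx Ky : H}
    (hx : x = p + y + β * p * y) (hq : q = x + y + β * x * y)
    (hK : factor (g n) p * Kx * factor (g n) q * Ky = Ky * factor (g n) q * Kx * factor (g n) p) :
    Commute (factor (g n) x * Kx * factor (g n) x) (factor (g n) y * Ky * factor (g n) y) := by
  have h1 : factor (g n) x = factor (g n) y * factor (g n) p :=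
    (hg.factor_mul hn (by rw [hx]; ring)).symm
  have h2 : factor (g n) p * factor (g n) y = factor (g n) x := hg.factor_mul hn hx
  have h3 : factor (g n) x * factor (g n) y = factor (g n) q := hg.factor_mul hn hq
  have h4 : factor (g n) y * factor (g n) x = factor (g n) q :=
    hg.factor_mul hn (by rw [hq]; ring)
  calc _ = factor (g n) x * Kx * (factor (g n) x * factor (g n) y) * Ky * factor (g n) y := by
          simp only [mul_assoc]
    _ = factor (g n) y * (factor (g n) p * Kx * factor (g n) q * Ky) * factor (g n) y := by
          rw [h3, h1]; simp only [mul_assoc]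
    _ = factor (g n) y * Ky * factor (g n) q * Kx * (factor (g n) p * factor (g n) y) := by
          rw [hK]; simp only [mul_assoc]
    _ = _ := by rw [h2, ← h4]; simp only [mul_assoc]

/-- If `K(x)` and `K(y)` satisfy the reflection equation with respect to `g_i` and commute with
`g_{i+1}, g_{i+2}, …`, then the elements `A_i(y) K(y) A_i(ȳ)⁻¹` commute. -/
theorem commute_sandwich (hg : IsTypeA β g) {i : ℕ} (hi : 1 ≤ i) {x y p q : A} {Kx Ky : H}
    (hx : x = p + y + β * p * y) (hq : q = x + y + β * x * y)
    (hKx : ∀ k > i, Commute Kx (g k)) (hKy : ∀ k > i, Commute Ky (g k))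
    (hK : factor (g i) p * Kx * factor (g i) q * Ky = Ky * factor (g i) q * Kx * factor (g i) p)
    (hcomm : Commute Kx Ky) {n : ℕ} (hn : i ≤ n) :
    Commute (desc g n i x * Kx * asc g n i x) (desc g n i y * Ky * asc g n i y) := by
  have key : ∀ n ≥ i, factor (g n) p * (desc g n i x * Kx * asc g n i x) * factor (g n) q
      * (desc g n i y * Ky * asc g n i y) = (desc g n i y * Ky * asc g n i y) * factor (g n) q
      * (desc g n i x * Kx * asc g n i x) * factor (g n) p := by
    intro n hn
    induction n, hn using Nat.le_induction with
    | base => simpa [desc_self, asc_self] using hK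
    | succ n hn ih =>
      have hc : ∀ (K : H) (z : A), (∀ k > i, Commute K (g k)) →
          Commute (desc g n i z * K * asc g n i z) (g (n + 1)) := by
        intro K z h
        have h1 : Commute (g (n + 1)) (desc g n i z) := by
          refine Commute.list_prod_right _ _ fun w hw => ?_
          obtain ⟨k, hk, rfl⟩ := List.mem_map.1 hw
          rw [List.mem_reverse, List.mem_range'_1] at hk
          exact (Commute.one_right _).add_right
            ((hg.comm k (by omega) (n + 1) (by omega)).symm.smul_right z)
        have h2 : Commute (g (n + 1)) (asc g n i z) := by
          refine Commute.list_prod_right _ _ fun w hw => ?_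
          obtain ⟨k, hk, rfl⟩ := List.mem_map.1 hw
          rw [List.mem_range'_1] at hk
          exact (Commute.one_right _).add_right
            ((hg.comm k (by omega) (n + 1) (by omega)).symm.smul_right z)
        exact ((h1.mul_right (h _ (by omega)).symm).mul_right h2).symm
      have := hg.reflection_step (by omega) hx hq (hc Kx x hKx) (hc Ky y hKy) ih
      rw [desc_top _ hn, asc_top _ hn, desc_top _ hn, asc_top _ hn]
      simpa only [mul_assoc] using this
  obtain rfl | hlt := hn.eq_or_lt
  · simpa [desc_self, asc_self] using hcomm
  · obtain ⟨n, rfl⟩ : ∃ m, n = m + 1 := ⟨n - 1, by omega⟩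
    have := hg.commute_of_reflection (n := n) (by omega) hx hq (key n (by omega))
    rw [desc_top _ (by omega), asc_top _ (by omega), desc_top _ (by omega), asc_top _ (by omega)]
    simpa only [mul_assoc] using this

end IsTypeA

end Products

/-! ### Exchange and reflection equations in type `D` -/

section Tails

variable {A H : Type*} [CommRing A] [Ring H] [Algebra A H] {β : A} {g : ℕ → H}

theorem IsTypeA.sandwich_mul_desc (hg : IsTypeA β g) {x z : A} (h : x + z + β * x * z = 0)
    (K : H) (n : ℕ) :
    desc g n 1 x * K * asc g n 1 x * desc g n 1 z = desc g n 1 x * K := by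
  rw [mul_assoc, hg.asc_mul_desc h n le_rfl, mul_one]

/-- The chain `g_0, g_2, g_3, …` of the diagram of type `D`, indexed from one. -/
def forkChain {H : Type*} (g : ℕ → H) (k : ℕ) : H := if k = 1 then g 0 else g k

theorem forkChain_of_two_le {H : Type*} (g : ℕ → H) {k : ℕ} (hk : 2 ≤ k) : g k = forkChain g k := by
  rw [forkChain, if_neg (by omega)]

theorem IsTypeA.forkChain (hg : IsTypeA β g) (hsq : g 0 * g 0 = β • g 0)
    (hcomm : ∀ k ≥ 3, Commute (g 0) (g k)) (hbraid : g 0 * g 2 * g 0 = g 2 * g 0 * g 2) :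
    IsTypeA β (forkChain g) where
  sq k hk := by
    unfold KGroth.forkChain
    split_ifs
    · exact hsq
    · exact hg.sq k hk
  comm k hk l hl := by
    unfold KGroth.forkChain
    rw [if_neg (show ¬ l = 1 by omega)]
    split_ifs
    · exact hcomm l (by omega)
    · exact hg.comm k hk l hl
  braid k hk := by
    unfold KGroth.forkChain
    rw [if_neg (show ¬ k + 1 = 1 by omega)]
    split_ifs with h
    · subst h; exact hbraid
    · exact hg.braid k hk

/-- The effect of the special reflection of type `D` on the leading factors. -/
theorem typeD_exchange (hg : IsTypeA β g) (hf : IsTypeA β (forkChain g))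
    (h01 : Commute (g 1) (g 0)) {x y z w p : A} (hz : x + z + β * x * z = 0)
    (hw : y + w + β * y * w = 0) (hp : p = x + y + β * x * y) {n : ℕ} (hn : 2 ≤ n) :
    (desc g n 2 x * (factor (g 1) x * factor (g 0) x) * asc g n 2 x) *
      (desc g n 2 y * (factor (g 1) y * factor (g 0) y) * asc g n 2 y) *
      (desc g n 1 w * desc g n 2 z) = desc g n 1 x * desc g n 2 y * factor (g 0) p := by
  have e0 : ∀ t : A, factor (g 0) t = factor (forkChain g 1) t := fun t => by simp [forkChain]
  have h1 : (desc g n 2 y * (factor (g 1) y * factor (g 0) y) * asc g n 2 y) * desc g n 1 w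
      = desc g n 2 y * factor (g 0) y := by
    calc _ = desc g n 2 y * (factor (g 1) y * factor (g 0) y) * (asc g n 2 y * desc g n 2 w)
          * factor (g 1) w := by rw [desc_bot g (i := 1) (y := w) (by omega)]; simp only [mul_assoc]
      _ = desc g n 2 y * (factor (g 0) y * (factor (g 1) y * factor (g 1) w)) := by
        rw [hg.asc_mul_desc hw n (by omega), (factor_commute h01 y y).eq]
        simp only [mul_assoc, mul_one]
      _ = _ := by rw [hg.factor_mul le_rfl hw.symm, factor_zero, mul_one]
  have h2 : desc g n 2 y * factor (g 0) y * desc g n 2 z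
      = desc g n 2 z * factor (g 0) z * desc g n 2 y * factor (g 0) p := by
    have := hf.desc_exchange (x := z) (y := y) (p := p) (n := n) (i := 1)
      (by rw [hp]; linear_combination (-1 - β * y) * hz) le_rfl (by omega)
    rw [desc_bot _ (by omega), desc_bot (forkChain g) (i := 1) (y := y) (by omega)] at this
    simp only [← desc_congr (fun k hk => forkChain_of_two_le g hk), ← e0, Nat.reduceAdd] at this
    exact this.symm
  calc _ = (desc g n 2 x * (factor (g 1) x * factor (g 0) x) * asc g n 2 x) *
        ((desc g n 2 y * (factor (g 1) y * factor (g 0) y) * asc g n 2 y) * desc g n 1 w)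
        * desc g n 2 z := by simp only [mul_assoc]
    _ = desc g n 2 x * (factor (g 1) x * factor (g 0) x) * asc g n 2 x *
        (desc g n 2 y * factor (g 0) y * desc g n 2 z) := by rw [h1]; simp only [mul_assoc]
    _ = desc g n 2 x * factor (g 1) x * (factor (g 0) x * ((asc g n 2 x * desc g n 2 z) *
        factor (g 0) z)) * desc g n 2 y * factor (g 0) p := by rw [h2]; simp only [mul_assoc]
    _ = _ := by
      rw [hg.asc_mul_desc hz n (by omega), one_mul, e0, e0 z, hf.factor_mul le_rfl hz.symm,
        factor_zero, mul_one, ← desc_bot _ (by omega)]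

/-- The reflection equation for `F_2^D(y) = h_1(y) h_{1̂}(y)` and the generator `u_2`. -/
theorem typeD_reflection (hg : IsTypeA β g) (hf : IsTypeA β (forkChain g))
    (h01 : Commute (g 1) (g 0)) {x y p q : A}
    (hx : x = p + y + β * p * y) (hq : q = x + y + β * x * y) :
    factor (g 2) p * (factor (g 1) x * factor (g 0) x) * factor (g 2) q *
        (factor (g 1) y * factor (g 0) y) =
      (factor (g 1) y * factor (g 0) y) * factor (g 2) q * (factor (g 1) x * factor (g 0) x) *
        factor (g 2) p := by
  have c := fun s t : A => (factor_commute h01 s t).eq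
  have yb := fun {x y q : A} (h : q = x + y + β * x * y) =>
    yangBaxter_three (hg.sq 1 le_rfl) (hg.sq 2 (by omega)) (hg.braid 1 le_rfl) h
  have yb' := fun {x y q : A} (h : q = x + y + β * x * y) => by
    simpa [forkChain] using
      yangBaxter_three (hf.sq 1 le_rfl) (hf.sq 2 (by omega)) (hf.braid 1 le_rfl) h
  have hx' : x = y + p + β * y * p := by rw [hx]; ring
  calc _ = factor (g 2) p * factor (g 1) x * (factor (g 0) x * factor (g 2) q * factor (g 0) y)
          * factor (g 1) y := by rw [c y y]; simp only [mul_assoc]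
    _ = (factor (g 2) p * factor (g 1) x * factor (g 2) y) * factor (g 0) q * factor (g 2) x
          * factor (g 1) y := by rw [yb' hq]; simp only [mul_assoc]
    _ = factor (g 1) y * factor (g 2) x * (factor (g 1) p * factor (g 0) q) * factor (g 2) x
          * factor (g 1) y := by rw [← yb hx']; simp only [mul_assoc]
    _ = factor (g 1) y * factor (g 2) x * factor (g 0) q * (factor (g 1) p * factor (g 2) x
          * factor (g 1) y) := by rw [c]; simp only [mul_assoc]
    _ = factor (g 1) y * (factor (g 2) x * factor (g 0) q * factor (g 2) y) * factor (g 1) x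
          * factor (g 2) p := by rw [yb hx]; simp only [mul_assoc]
    _ = factor (g 1) y * factor (g 0) y * factor (g 2) q * (factor (g 0) x * factor (g 1) x)
          * factor (g 2) p := by
        rw [← yb' (x := y) (y := x) (by rw [hq]; ring)]; simp only [mul_assoc]
    _ = _ := by rw [← c]

end Tails

/-! ### Bruhat order and right multiplication in the idCoxeter algebra -/

section Combinatorics

variable {I W : Type*} [Group W] {M : CoxeterMatrix I} (cs : CoxeterSystem M W)

theorem rightInvSeq_append (ω ω' : List I) :
    cs.rightInvSeq (ω ++ ω') = ((cs.rightInvSeq ω).map fun t =>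
      (cs.wordProd ω')⁻¹ * t * cs.wordProd ω') ++ cs.rightInvSeq ω' := by
  induction ω with
  | nil => simp
  | cons i ω ih =>
    rw [List.cons_append, CoxeterSystem.rightInvSeq, ih, CoxeterSystem.rightInvSeq]
    simp [cs.wordProd_append, mul_assoc]

/-- If `s_j` is a right descent of `p v` but not of `v`, then the reflection `v s_j v⁻¹` is a right
inversion of `p`. -/
theorem length_mul_conj_lt {p v : W} {j : I} (hv : cs.length v < cs.length (v * cs.simple j))
    (hpv : cs.length (p * v * cs.simple j) < cs.length (p * v)) :
    cs.length (p * (v * cs.simple j * v⁻¹)) < cs.length p := by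
  obtain ⟨π, hπ, rfl⟩ := cs.exists_isReduced p
  obtain ⟨ω, hω, rfl⟩ := cs.exists_isReduced v
  rw [← cs.wordProd_append] at hpv
  have hm := strong_exchange cs (cs.isReflection_simple j) _ hpv
  rw [rightInvSeq_append, List.mem_append, List.mem_map] at hm
  rcases hm with ⟨t, ht, e⟩ | hm
  · have : cs.wordProd ω * cs.simple j * (cs.wordProd ω)⁻¹ = t := by rw [← e]; group
    rw [this]
    exact (cs.isRightInversion_of_mem_rightInvSeq hπ ht).2
  · have := (cs.isRightInversion_of_mem_rightInvSeq hω hm).2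
    omega

theorem bruhatLE_finite (w : W) : {p | BruhatLE cs p w}.Finite := by
  induction hn : cs.length w using Nat.strong_induction_on generalizing w with
  | _ n ih =>
    obtain ⟨ω, hω, rfl⟩ := cs.exists_isReduced w
    have hsub : {p | BruhatLE cs p (cs.wordProd ω)} ⊆ {cs.wordProd ω} ∪
        ⋃ t ∈ {t | t ∈ cs.rightInvSeq ω}, {p | BruhatLE cs p (cs.wordProd ω * t)} := by
      intro p hp
      rcases Relation.ReflTransGen.cases_tail hp with h | ⟨c, hpc, t, ht, e, hl⟩
      · exact Or.inl h.symm
      · have hc : cs.wordProd ω * t = c := by rw [e, mul_assoc, ht.mul_self, mul_one]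
        refine Or.inr (Set.mem_biUnion (strong_exchange cs ht ω (by rwa [hc])) ?_)
        change BruhatLE cs p (cs.wordProd ω * t)
        rwa [hc]
    refine Set.Finite.subset ((Set.finite_singleton _).union
      (Set.Finite.biUnion (List.finite_toSet _) fun t ht => ?_)) hsub
    have := (cs.isRightInversion_of_mem_rightInvSeq hω ht).2
    exact ih _ (by omega) _ rfl

variable {A : Type*} [CommRing A] (β : A)

open Classical in
/-- Right multiplication by `u_j` on formal, possibly infinite, sums `∑ f(w) u_w`. -/
noncomputable def rightMul (j : I) (f : W → A) (w : W) : A :=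
  if cs.length (w * cs.simple j) < cs.length w then f (w * cs.simple j) + β * f w else 0

/-- Right multiplication of a formal sum by `u_{i_1} ⋯ u_{i_k}` along a word `(i_1, …, i_k)`. -/
noncomputable def rightMulWord (ω : List I) (f : W → A) : W → A :=
  ω.foldl (fun f j => rightMul cs β j f) f

theorem rightMulWord_cons (j : I) (ω : List I) (f : W → A) :
    rightMulWord cs β (j :: ω) f = rightMulWord cs β ω (rightMul cs β j f) := rfl

theorem rightMulWord_concat (j : I) (ω : List I) (f : W → A) :
    rightMulWord cs β (ω ++ [j]) f = rightMul cs β j (rightMulWord cs β ω f) := by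
  simp [rightMulWord]

theorem rightMulWord_add_smul (ω : List I) (r : A) (f f' : W → A) :
    rightMulWord cs β ω (f + r • f') = rightMulWord cs β ω f + r • rightMulWord cs β ω f' := by
  induction ω generalizing f f' with
  | nil => rfl
  | cons j ω ih =>
    simp only [rightMulWord_cons, ← ih]
    congr 1
    funext w
    simp only [rightMul, Pi.add_apply, Pi.smul_apply, smul_eq_mul]
    split_ifs <;> ring

theorem map_rightMulWord {σ : A →+* A} (hσ : σ β = β) (ω : List I) (f : W → A) (w : W) :
    σ (rightMulWord cs β ω f w) = rightMulWord cs β ω (fun v => σ (f v)) w := by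
  induction ω generalizing f with
  | nil => rfl
  | cons j ω ih =>
    rw [rightMulWord_cons, ih, rightMulWord_cons]
    congr 1
    funext v
    simp only [rightMul]
    split_ifs <;> simp [hσ]

/-- Each coefficient of `f · u_ω` involves only finitely many coefficients of `f`. -/
theorem rightMulWord_finite_dependence (ω : List I) (w : W) : ∃ S : Finset W, ∀ f f' : W → A,
    (∀ v ∈ S, f v = f' v) → rightMulWord cs β ω f w = rightMulWord cs β ω f' w := by
  classical
  induction ω with
  | nil => exact ⟨{w}, fun f f' h => h w (by simp)⟩
  | cons j ω ih =>
    obtain ⟨S, hS⟩ := ih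
    refine ⟨S ∪ S.image (· * cs.simple j), fun f f' h => hS _ _ fun v hv => ?_⟩
    have h1 := h v (Finset.mem_union_left _ hv)
    have h2 := h (v * cs.simple j) (Finset.mem_union_right _ (Finset.mem_image_of_mem _ hv))
    simp only [rightMul, h1, h2]

/-- If `u_w` occurs in `f · u_v`, then `w v⁻¹ ≤ w`. -/
theorem bruhatLE_of_rightMulWord_ne_zero {ω : List I} (hω : cs.IsReduced ω) (f : W → A) {w : W}
    (h : rightMulWord cs β ω f w ≠ 0) : BruhatLE cs (w * (cs.wordProd ω)⁻¹) w := by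
  induction ω using List.reverseRecOn generalizing w with
  | nil =>
    rw [cs.wordProd_nil, inv_one, mul_one]
    exact Relation.ReflTransGen.refl
  | append_singleton ω j ih =>
    have hω' : cs.IsReduced ω := by simpa using hω.take ω.length
    have hup : cs.length (cs.wordProd ω) < cs.length (cs.wordProd ω * cs.simple j) := by
      unfold CoxeterSystem.IsReduced at hω hω'
      rw [cs.wordProd_append, cs.wordProd_singleton, List.length_append] at hω
      simp only [List.length_singleton] at hω
      omega
    rw [rightMulWord_concat, rightMul] at h
    split_ifs at h with hd
    · have e : w * (cs.wordProd (ω ++ [j]))⁻¹ = w * cs.simple j * (cs.wordProd ω)⁻¹ := by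
        simp [cs.wordProd_append, mul_assoc]
      by_cases h1 : rightMulWord cs β ω f (w * cs.simple j) = 0
      · rw [h1, zero_add] at h
        have h2 := ih hω' (right_ne_zero_of_mul h)
        refine Relation.ReflTransGen.head
          ⟨cs.wordProd ω * cs.simple j * (cs.wordProd ω)⁻¹,
            (cs.isReflection_simple j).conj _, ?_, ?_⟩ h2
        · rw [e]
          simp [mul_assoc]
        · have := length_mul_conj_lt cs (p := w * (cs.wordProd ω)⁻¹) hup (by simpa using hd)
          rw [e]
          convert this using 2
          group
      · rw [e]
        exact (ih hω' h1).tail ⟨cs.simple j, cs.isReflection_simple j, by simp, hd⟩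
    · exact absurd rfl h

theorem rightOp_apply (j : I) (f : W →₀ A) (w : W) :
    rightOp cs β j f w = rightMul cs β j f w := by
  classical
  induction f using Finsupp.induction_linear with
  | zero => simp [rightMul]
  | add f f' h h' =>
    rw [map_add, Finsupp.add_apply, h, h']
    simp only [rightMul, Finsupp.add_apply]
    split_ifs <;> ring
  | single v r =>
    rw [← mul_one r, ← smul_eq_mul, ← Finsupp.smul_single, map_smul, Finsupp.smul_apply,
      rightOp_single]
    have hv := cs.length_mul_simple v j
    simp only [rightMul, Finsupp.smul_apply, smul_eq_mul]
    rcases eq_or_ne v w with rfl | hne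
    · have hs : v ≠ v * cs.simple j := fun h => cs.length_mul_simple_ne v j (congrArg cs.length h.symm)
      by_cases hup : cs.length v < cs.length (v * cs.simple j)
      · rw [if_pos hup, if_neg (by omega)]
        simp [hs.symm]
      · rw [if_neg hup, if_pos (by omega)]
        simp only [Finsupp.smul_apply, Finsupp.single_apply, smul_eq_mul, if_true, if_neg hs]
        ring
    · by_cases hs : v = w * cs.simple j
      · subst hs
        simp only [cs.simple_mul_simple_cancel_right] at hv ⊢
        split_ifs
        · simp [hne]
        · simp [hne]
      · have hs' : v * cs.simple j ≠ w := by rintro rfl; simp at hs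
        split_ifs <;> simp [hne, hs, hs']

theorem leftOp_apply (j : I) (f : W →₀ A) (w : W) : leftOp cs β j f w =
    open Classical in if cs.length (cs.simple j * w) < cs.length w
      then f (cs.simple j * w) + β * f w else 0 := by
  classical
  induction f using Finsupp.induction_linear with
  | zero => simp
  | add f f' h h' =>
    rw [map_add, Finsupp.add_apply, h, h']
    simp only [Finsupp.add_apply]
    split_ifs <;> ring
  | single v r =>
    rw [← mul_one r, ← smul_eq_mul, ← Finsupp.smul_single, map_smul, Finsupp.smul_apply,
      leftOp_single]
    have hv := cs.length_simple_mul v j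
    simp only [Finsupp.smul_apply, smul_eq_mul]
    rcases eq_or_ne v w with rfl | hne
    · have hs : v ≠ cs.simple j * v := fun h => cs.length_simple_mul_ne v j (congrArg cs.length h.symm)
      by_cases hup : cs.length v < cs.length (cs.simple j * v)
      · rw [if_pos hup, if_neg (by omega)]
        simp [hs.symm]
      · rw [if_neg hup, if_pos (by omega)]
        simp only [Finsupp.smul_apply, Finsupp.single_apply, smul_eq_mul, if_true, if_neg hs]
        ring
    · by_cases hs : v = cs.simple j * w
      · subst hs
        simp only [cs.simple_mul_simple_cancel_left] at hv ⊢
        split_ifs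
        · simp [hne]
        · simp [hne]
      · have hs' : cs.simple j * v ≠ w := by rintro rfl; simp at hs
        split_ifs <;> simp [hne, hs, hs']

/-- The composition of the operators `rightOp` that multiplies by `u_{i_1} ⋯ u_{i_k}`. -/
noncomputable def rightOpWord (ω : List I) : Module.End A (W →₀ A) :=
  (ω.reverse.map (rightOp cs β)).prod

theorem rightOpWord_cons (j : I) (ω : List I) (f : W →₀ A) :
    rightOpWord cs β (j :: ω) f = rightOpWord cs β ω (rightOp cs β j f) := by
  simp [rightOpWord]

theorem rightOpWord_apply (ω : List I) (f : W →₀ A) (w : W) :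
    rightOpWord cs β ω f w = rightMulWord cs β ω f w := by
  induction ω generalizing f with
  | nil => simp [rightOpWord, rightMulWord]
  | cons j ω ih =>
    rw [rightOpWord_cons, ih, rightMulWord_cons]
    congr 1
    funext v
    exact rightOp_apply cs β j f v

theorem rightOpWord_single_one {ω : List I} (hω : cs.IsReduced ω) :
    rightOpWord cs β ω (Finsupp.single (1 : W) (1 : A)) = Finsupp.single (cs.wordProd ω) 1 := by
  induction ω using List.reverseRecOn with
  | nil => simp [rightOpWord]
  | append_singleton ω j ih =>
    have hω' : cs.IsReduced ω := by simpa using hω.take ω.length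
    have e : rightOpWord (A := A) cs β (ω ++ [j]) = rightOp cs β j * rightOpWord cs β ω := by
      simp [rightOpWord]
    rw [e, Module.End.mul_apply, ih hω', rightOp_up, cs.wordProd_append, cs.wordProd_singleton]
    unfold CoxeterSystem.IsReduced at hω hω'
    rw [cs.wordProd_append, cs.wordProd_singleton, List.length_append] at hω
    simp only [List.length_singleton] at hω
    omega

theorem leftOp_rightOpWord_comm (i : I) (ω : List I) :
    Commute (leftOp (A := A) cs β i) (rightOpWord cs β ω) := by
  refine Commute.list_prod_right _ _ fun x hx => ?_
  obtain ⟨j, -, rfl⟩ := List.mem_map.1 hx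
  exact leftOp_rightOp_comm cs β i j

theorem rightOpWord_eq_of_wordProd_eq {ω ω' : List I} (hω : cs.IsReduced ω)
    (hω' : cs.IsReduced ω') (h : cs.wordProd ω = cs.wordProd ω') :
    rightOpWord (A := A) cs β ω = rightOpWord cs β ω' := by
  refine end_ext fun w => ?_
  obtain ⟨π, hπ, rfl⟩ := cs.exists_isReduced w
  have hc : ∀ ω : List I, Commute (π.map (leftOp (A := A) cs β)).prod (rightOpWord cs β ω) :=
    fun ω => Commute.list_prod_left _ _ fun x hx => by
      obtain ⟨i, -, rfl⟩ := List.mem_map.1 hx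
      exact leftOp_rightOpWord_comm cs β i ω
  rw [← leftOp_reduced cs β π hπ, ← Module.End.mul_apply, ← Module.End.mul_apply, ← (hc ω).eq,
    ← (hc ω').eq, Module.End.mul_apply, Module.End.mul_apply, rightOpWord_single_one cs β hω,
    rightOpWord_single_one cs β hω', h]

/-- `f · u_v` does not depend on the reduced word of `v`. -/
theorem rightMulWord_eq_of_wordProd_eq {ω ω' : List I} (hω : cs.IsReduced ω)
    (hω' : cs.IsReduced ω') (h : cs.wordProd ω = cs.wordProd ω') (f : W → A) :
    rightMulWord cs β ω f = rightMulWord cs β ω' f := by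
  classical
  funext w
  obtain ⟨S, hS⟩ := rightMulWord_finite_dependence (A := A) cs β ω w
  obtain ⟨S', hS'⟩ := rightMulWord_finite_dependence (A := A) cs β ω' w
  -- truncating `f` to the finitely many coefficients that matter makes it an element of `W →₀ A`
  let f' : W →₀ A := Finsupp.onFinset (S ∪ S') (fun v => if v ∈ S ∪ S' then f v else 0)
    fun v hv => by by_contra h; simp [h] at hv
  have hf : ∀ v ∈ S ∪ S', f v = f' v := fun v hv => by
    rw [Finsupp.onFinset_apply, if_pos hv]
  rw [hS f f' fun v hv => hf v (Finset.mem_union_left _ hv),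
    hS' f f' fun v hv => hf v (Finset.mem_union_right _ hv), ← rightOpWord_apply,
    ← rightOpWord_apply, rightOpWord_eq_of_wordProd_eq cs β hω hω' h]

theorem regularRep_commute_rightOp (y : IdCoxeter M β) (j : I) :
    Commute (regularRep cs β y) (rightOp cs β j) := by
  obtain ⟨z, rfl⟩ := RingQuot.mkAlgHom_surjective A (IdRel M β) y
  induction z using FreeAlgebra.induction with
  | grade0 r =>
    rw [AlgHom.commutes, AlgHom.commutes]
    exact Algebra.commutes _ _
  | grade1 i =>
    have := leftOp_rightOp_comm cs β i j
    rwa [← regularRep_u] at this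
  | mul a b ha hb => rw [map_mul, map_mul]; exact ha.mul_left hb
  | add a b ha hb => rw [map_add, map_add]; exact ha.add_left hb

theorem regularRep_commute_rightOpWord (y : IdCoxeter M β) (ω : List I) :
    Commute (regularRep cs β y) (rightOpWord cs β ω) := by
  refine Commute.list_prod_right _ _ fun x hx => ?_
  obtain ⟨j, -, rfl⟩ := List.mem_map.1 hx
  exact regularRep_commute_rightOp cs β y j

theorem coeffU_mul_u (y : IdCoxeter M β) (j : I) (w : W) :
    coeffU cs β w (y * u M β j) = rightMul cs β j (fun v => coeffU cs β v y) w := by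
  have h1 : leftOp cs β j (Finsupp.single (1 : W) (1 : A)) =
      rightOp cs β j (Finsupp.single 1 1) := by
    rw [leftOp_up _ _ (by simp), rightOp_up _ _ (by simp)]; simp
  have h2 := congrArg (fun T => T (Finsupp.single (1 : W) (1 : A)))
    (regularRep_commute_rightOp cs β y j).eq
  simp only [Module.End.mul_apply] at h2
  rw [coeffU, map_mul, regularRep_u, Module.End.mul_apply, h1, h2, rightOp_apply]
  rfl

/-- The coefficients of a product in the idCoxeter algebra. Only the `v` with `w v⁻¹ ≤ w`
contribute. -/
theorem coeffU_mul (y z : IdCoxeter M β) (w : W) (ω : W → List I)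
    (hω : ∀ v, cs.IsReduced (ω v)) (hv : ∀ v, cs.wordProd (ω v) = v) (T : Finset W)
    (hT : ∀ v, BruhatLE cs (w * v⁻¹) w → v ∈ T) :
    coeffU cs β w (y * z) =
      ∑ v ∈ T, rightMulWord cs β (ω v) (fun p => coeffU cs β p y) w * coeffU cs β v z := by
  classical
  have key : ∀ v, regularRep cs β y (Finsupp.single v 1) w
      = rightMulWord cs β (ω v) (fun p => coeffU cs β p y) w := by
    intro v
    have h2 := congrArg (fun T => T (Finsupp.single (1 : W) (1 : A)))
      (regularRep_commute_rightOpWord cs β y (ω v)).eq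
    simp only [Module.End.mul_apply] at h2
    rw [rightOpWord_single_one cs β (hω v), hv] at h2
    rw [h2, rightOpWord_apply]
    rfl
  set F := regularRep cs β z (Finsupp.single 1 1) with hF
  have e : coeffU cs β w (y * z) = F.sum fun v r => r * regularRep cs β y (Finsupp.single v 1) w := by
    rw [coeffU, map_mul, Module.End.mul_apply, ← hF]
    conv_lhs => rw [← F.sum_single]
    rw [Finsupp.sum, Finsupp.sum, map_sum, Finsupp.finsetSum_apply]
    refine Finset.sum_congr rfl fun v _ => ?_
    rw [← mul_one (F v), ← smul_eq_mul, ← Finsupp.smul_single, map_smul, Finsupp.smul_apply]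
    simp
  rw [e, Finsupp.sum]
  have h0 : ∀ v ∉ T, rightMulWord cs β (ω v) (fun p => coeffU cs β p y) w = 0 := by
    intro v hvT
    by_contra hne
    have := bruhatLE_of_rightMulWord_ne_zero cs β (hω v) _ hne
    rw [hv] at this
    exact hvT (hT v this)
  rw [Finset.sum_subset (Finset.subset_union_left (s₂ := T)),
    ← Finset.sum_subset (Finset.subset_union_right (s₁ := F.support))]
  · exact Finset.sum_congr rfl fun v _ => by rw [key, mul_comm]; rfl
  · intro v _ hvT
    rw [key, h0 v hvT, mul_zero]
  · intro v _ hv'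
    rw [Finsupp.notMem_support_iff.1 hv', zero_mul]

end Combinatorics

/-! ### Inverses for `⊕` and substitutions -/

section Series

open MvPowerSeries

theorem constantCoeff_va (i : ℕ) : constantCoeff (va i) = 0 := by simp [va]
theorem constantCoeff_vb (i : ℕ) : constantCoeff (vb i) = 0 := by simp [vb]
theorem constantCoeff_vc (i : ℕ) : constantCoeff (vc i) = 0 := by simp [vc]
theorem constantCoeff_vx (i : ℕ) : constantCoeff (vx i) = 0 := by simp [vx]

theorem oplus_bar {f : Ser} (hf : constantCoeff f = 0) : f + bar f + beta * f * bar f = 0 := by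
  have h : (1 + beta * f) * invOfUnit (1 + beta * f) 1 = 1 :=
    mul_invOfUnit _ _ (by simp [hf])
  unfold bar
  linear_combination (-f) * h

theorem constantCoeff_bar {f : Ser} (hf : constantCoeff f = 0) : constantCoeff (bar f) = 0 := by
  simp [bar, hf]

theorem constantCoeff_oplus {f g : Ser} (hf : constantCoeff f = 0) (hg : constantCoeff g = 0) :
    constantCoeff (oplus f g) = 0 := by
  simp [oplus, hf, hg]

/-- The inverse for `⊕` is unique. -/
theorem bar_eq_of_oplus_eq_zero {f g : Ser} (hf : constantCoeff f = 0)
    (h : f + g + beta * f * g = 0) : bar f = g := by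
  have hb := oplus_bar hf
  linear_combination (1 + beta * g) * hb - (1 + beta * bar f) * h

theorem bar_bar {f : Ser} (hf : constantCoeff f = 0) : bar (bar f) = f :=
  bar_eq_of_oplus_eq_zero (constantCoeff_bar hf) (by linear_combination oplus_bar hf)

theorem bar_zero : bar 0 = 0 := by simp [bar]

theorem X_dvd_bar {t : Var} {f : Ser} (h : MvPowerSeries.X t ∣ f) : MvPowerSeries.X t ∣ bar f := by
  unfold bar
  exact (h.mul_right _).neg_right

/-- The index of a variable. -/
def Var.index : Var → ℕ
  | .a i => i
  | .b i => i
  | .c i => i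
  | .x i => i

theorem finite_index_le (n : ℕ) : {t : Var | t.index ≤ n}.Finite := by
  have h : {t : Var | t.index ≤ n} ⊆ (Var.a '' Set.Iic n ∪ Var.b '' Set.Iic n) ∪
      (Var.c '' Set.Iic n ∪ Var.x '' Set.Iic n) := by
    rintro (i | i | i | i) (hi : i ≤ n)
    · exact Or.inl (Or.inl ⟨i, hi, rfl⟩)
    · exact Or.inl (Or.inr ⟨i, hi, rfl⟩)
    · exact Or.inr (Or.inl ⟨i, hi, rfl⟩)
    · exact Or.inr (Or.inr ⟨i, hi, rfl⟩)
  exact ((((Set.finite_Iic n).image _).union ((Set.finite_Iic n).image _)).union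
    (((Set.finite_Iic n).image _).union ((Set.finite_Iic n).image _))).subset h

/-- A family of series can be substituted for the variables if the image of every variable is
divisible by a variable whose index is not much smaller. -/
theorem hasSubst_of_X_dvd {p : Var → Ser}
    (h : ∀ s, ∃ t : Var, s.index ≤ t.index + 2 ∧ MvPowerSeries.X t ∣ p s) : HasSubst p where
  const_coeff s := by
    obtain ⟨t, -, q, hq⟩ := h s
    simp [hq]
  coeff_zero d := by
    refine (d.support.finite_toSet.biUnion fun t _ => finite_index_le (t.index + 2)).subset ?_
    intro s hs
    obtain ⟨t, ht, hd⟩ := h s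
    refine Set.mem_biUnion (x := t) ?_ ht
    by_contra hn
    exact hs (X_dvd_iff.1 hd d (by simpa using hn))

theorem hasSubst_reflVar (X : ClassicalType) (i : ℕ) : HasSubst (reflVar X i) := by
  refine hasSubst_of_X_dvd fun s => ?_
  have hid : ∀ s : Var, reflVar X i s = MvPowerSeries.X s →
      ∃ t : Var, s.index ≤ t.index + 2 ∧ MvPowerSeries.X t ∣ reflVar X i s :=
    fun s hs => ⟨s, by omega, by rw [hs]⟩
  rcases i with _ | i
  · exact match X, s with
      | .A, .a _ | .A, .x _ | .B, .a 0 | .B, .a (_ + 2) | .B, .x 0 | .C, .a 0 | .C, .a (_ + 2)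
      | .C, .x 0 | .D, .a 0 | .D, .a (_ + 3) | .D, .x 0
      | .A, .b _ | .A, .c _ | .B, .b _ | .B, .c _ | .C, .b _ | .C, .c _ | .D, .b _ | .D, .c _ =>
        hid _ rfl
      | .B, .a 1 | .C, .a 1 => ⟨Var.a 1, by simp [Var.index], X_dvd_bar dvd_rfl⟩
      | .D, .a 1 => ⟨Var.a 2, by simp [Var.index], X_dvd_bar dvd_rfl⟩
      | .D, .a 2 => ⟨Var.a 1, by simp [Var.index], X_dvd_bar dvd_rfl⟩
      | .B, .x 1 | .C, .x 1 | .D, .x 1 => ⟨Var.a 1, by simp [Var.index], dvd_rfl⟩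
      | .D, .x 2 => ⟨Var.a 2, by simp [Var.index], dvd_rfl⟩
      | .B, .x (k + 2) | .C, .x (k + 2) | .D, .x (k + 3) =>
        ⟨Var.x (k + 1), by simp [Var.index], dvd_rfl⟩
  · rcases s with s | s | s | s
    · refine ⟨Var.a (Equiv.swap (i + 1) (i + 2) s), ?_, by cases X <;> exact dvd_rfl⟩
      simp only [Var.index, Equiv.swap_apply_def]
      split_ifs <;> omega
    all_goals cases X <;> exact hid _ rfl

/-- A substitution as a ring endomorphism. -/
noncomputable def substHom {p : Var → Ser} (hp : HasSubst p) : Ser →+* Ser :=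
  (substAlgHom (R := Polynomial ℤ) hp).toRingHom

theorem substHom_apply {p : Var → Ser} (hp : HasSubst p) (f : Ser) :
    substHom hp f = subst p f := by
  rw [← coe_substAlgHom hp]; rfl

theorem substHom_beta {p : Var → Ser} (hp : HasSubst p) : substHom hp beta = beta :=
  (substAlgHom (R := Polynomial ℤ) hp).commutes Polynomial.X

theorem substHom_X {p : Var → Ser} (hp : HasSubst p) (t : Var) :
    substHom hp (MvPowerSeries.X t) = p t := by
  rw [substHom_apply, subst_X hp]

end Series

/-! ### Coefficientwise limits -/

section Limits

open MvPowerSeries Filter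

theorem IsLimit.unique {fs : ℕ → Ser} {f f' : Ser} (h : IsLimit fs f) (h' : IsLimit fs f') :
    f = f' := by
  ext1 d
  obtain ⟨n, hn, hn'⟩ := ((h d).and (h' d)).exists
  rw [← hn, hn']

theorem isLimit_const (f : Ser) : IsLimit (fun _ => f) f := fun _ => Eventually.of_forall fun _ => rfl

theorem IsLimit.congr {fs gs : ℕ → Ser} {f : Ser} (h : IsLimit fs f)
    (hg : ∀ᶠ n in atTop, fs n = gs n) : IsLimit gs f := fun d => by
  filter_upwards [h d, hg] with n hn hn'
  rw [← hn', hn]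

theorem IsLimit.shift {fs : ℕ → Ser} {f : Ser} (h : IsLimit fs f) (k : ℕ) :
    IsLimit (fun n => fs (n + k)) f := fun d =>
  (tendsto_add_atTop_nat k).eventually (h d)

theorem IsLimit.add {fs gs : ℕ → Ser} {f g : Ser} (hf : IsLimit fs f) (hg : IsLimit gs g) :
    IsLimit (fun n => fs n + gs n) (f + g) := fun d => by
  filter_upwards [hf d, hg d] with n h h'
  rw [map_add, map_add, h, h']

theorem IsLimit.mul {fs gs : ℕ → Ser} {f g : Ser} (hf : IsLimit fs f) (hg : IsLimit gs g) :
    IsLimit (fun n => fs n * gs n) (f * g) := fun d => by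
  classical
  have h : ∀ᶠ n in atTop, ∀ p ∈ Finset.HasAntidiagonal.antidiagonal d,
      coeff p.1 (fs n) = coeff p.1 f ∧ coeff p.2 (gs n) = coeff p.2 g :=
    (Filter.eventually_all_finset _).2 fun p _ => (hf p.1).and (hg p.2)
  filter_upwards [h] with n h
  rw [coeff_mul, coeff_mul]
  exact Finset.sum_congr rfl fun p hp => by rw [(h p hp).1, (h p hp).2]

theorem IsLimit.sum {ι : Type*} {T : Finset ι} {fs : ι → ℕ → Ser} {f : ι → Ser}
    (h : ∀ i ∈ T, IsLimit (fs i) (f i)) :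
    IsLimit (fun n => ∑ i ∈ T, fs i n) (∑ i ∈ T, f i) := by
  classical
  induction T using Finset.induction_on with
  | empty => simpa using isLimit_const 0
  | insert i T hi ih =>
    simp only [Finset.sum_insert hi]
    exact (h i (Finset.mem_insert_self _ _)).add
      (ih fun k hk => h k (Finset.mem_insert_of_mem hk))

open WithPiTopology in
/-- Substitutions commute with limits. -/
theorem IsLimit.subst {p : Var → Ser} (hp : HasSubst p) {fs : ℕ → Ser} {f : Ser}
    (h : IsLimit fs f) :
    IsLimit (fun n => substHom hp (fs n)) (substHom hp f) := by
  let _ : UniformSpace (Polynomial ℤ) := ⊥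
  have _ : DiscreteTopology (Polynomial ℤ) := ⟨rfl⟩
  have key : ∀ (gs : ℕ → Ser) (g : Ser), IsLimit gs g ↔ Tendsto gs atTop (nhds g) := by
    intro gs g
    simp only [tendsto_iff_coeff_tendsto, nhds_discrete, tendsto_pure]
    rfl
  rw [key] at h ⊢
  simp only [substHom_apply]
  exact ((continuous_subst hp).tendsto f).comp h

end Limits

/-! ### The products `G_n^X` for general generators -/

section GeneralProducts

variable {A H : Type*} [CommRing A] [Ring H] [Algebra A H]

/-- The product defining `F_n^X(y)`, for arbitrary elements `g_0, g_1, …` of an algebra in place of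
the generators `u_i` (indexed by the names of the simple reflections). -/
def genF : ClassicalType → (ℕ → H) → ℕ → A → H
  | .A, _, _, _ => 1
  | .B, g, n, y => desc g n 1 y * factor (g 0) y * asc g n 1 y
  | .C, g, n, y => desc g n 1 y * factor (g 0) y ^ 2 * asc g n 1 y
  | .D, g, n, y => desc g n 2 y * (factor (g 1) y * factor (g 0) y) * asc g n 2 y

/-- The product `F_n^X(y_1) ⋯ F_n^X(y_N)`. -/
def genBoldF (X : ClassicalType) (g : ℕ → H) (n N : ℕ) (y : ℕ → A) : H :=
  ((List.range N).map fun i => genF X g n (y (i + 1))).prod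

/-- The product `A_1^{(n)}(p_1) ⋯ A_{n-1}^{(n)}(p_{n-1})`. -/
def genGA (g : ℕ → H) (n : ℕ) (p : ℕ → A) : H :=
  ((List.range' 1 (n - 1)).map fun i => desc g n i (p i)).prod

/-- The product `A_{n-1}^{(n)}(q̄_{n-1})⁻¹ ⋯ A_1^{(n)}(q̄_1)⁻¹`, the inverse of `genGA` at `q̄`. -/
def genGAInv (g : ℕ → H) (n : ℕ) (q : ℕ → A) : H :=
  ((List.range' 1 (n - 1)).reverse.map fun i => asc g n i (q i)).prod

/-- The product `G_n^X(a, b; x)` with `N` variables `x`. -/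
def genG (X : ClassicalType) (g : ℕ → H) (n N : ℕ) (a b x : ℕ → A) : H :=
  genGAInv g n b * genBoldF X g n N x * genGA g n a

theorem genF_zero (X : ClassicalType) (g : ℕ → H) (n : ℕ) : genF X g n (0 : A) = 1 := by
  cases X <;> simp [genF, desc_zero, asc_zero, factor_zero]

theorem genBoldF_succ (X : ClassicalType) (g : ℕ → H) (n N : ℕ) (y : ℕ → A) :
    genBoldF X g n (N + 1) y = genBoldF X g n N y * genF X g n (y (N + 1)) := by
  simp [genBoldF, List.range_succ]

theorem genBoldF_succ' (X : ClassicalType) (g : ℕ → H) (n N : ℕ) (y : ℕ → A) :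
    genBoldF X g n (N + 1) y = genF X g n (y 1) * genBoldF X g n N (fun i => y (i + 1)) := by
  simp [genBoldF, List.range_succ_eq_map, Function.comp_def]

theorem genBoldF_congr (X : ClassicalType) (g : ℕ → H) (n N : ℕ) {y y' : ℕ → A}
    (h : ∀ i, y (i + 1) = y' (i + 1)) : genBoldF X g n N y = genBoldF X g n N y' := by
  simp only [genBoldF, h]

theorem genBoldF_zero (X : ClassicalType) (g : ℕ → H) (n N : ℕ) :
    genBoldF X g n N (0 : ℕ → A) = 1 := by
  refine List.prod_eq_one fun z hz => ?_
  obtain ⟨i, -, rfl⟩ := List.mem_map.1 hz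
  exact genF_zero X g n

/-- `F_n^X(y) = 1 + y T` for some `T`. -/
theorem genF_eq_one_add (X : ClassicalType) (g : ℕ → H) (n : ℕ) (y : A) :
    ∃ T, genF X g n y = 1 + y • T := by
  let P : H → Prop := fun z => ∃ T, z = 1 + y • T
  have hone : P 1 := ⟨0, by simp⟩
  have hmul : ∀ z z', P z → P z' → P (z * z') := by
    rintro _ _ ⟨T, rfl⟩ ⟨T', rfl⟩
    refine ⟨T + T' + y • (T * T'), ?_⟩
    simp only [mul_add, add_mul, one_mul, mul_one, smul_mul_assoc, mul_smul_comm]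
    module
  have hf : ∀ k, P (factor (g k) y) := fun k => ⟨g k, rfl⟩
  have hlist : ∀ l : List ℕ, P (l.map fun k => factor (g k) y).prod := by
    intro l
    induction l with
    | nil => simpa using hone
    | cons k l ih => simpa using hmul _ _ (hf k) ih
  cases X
  · exact hone
  · exact hmul _ _ (hmul _ _ (hlist _) (hf 0)) (hlist _)
  · rw [genF, pow_two]
    exact hmul _ _ (hmul _ _ (hlist _) (hmul _ _ (hf 0) (hf 0))) (hlist _)
  · exact hmul _ _ (hmul _ _ (hlist _) (hmul _ _ (hf 1) (hf 0))) (hlist _)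

/-- A multiplicative relation between algebra elements that holds between the factors of two
products `genG` holds between these products. -/
theorem genG_rel {R : H → H → Prop} (hone : R 1 1)
    (hmul : ∀ {z z' w w'}, R z z' → R w w' → R (z * w) (z' * w')) {g g' : ℕ → H} {σ : A → A}
    (hf : ∀ k y, R (factor (g k) y) (factor (g' k) (σ y))) (X : ClassicalType) (n N : ℕ)
    (a b x : ℕ → A) :
    R (genG X g n N a b x)
      (genG X g' n N (fun i => σ (a i)) (fun i => σ (b i)) (fun i => σ (x i))) := by
  have hlist : ∀ (l : List ℕ) (z z' : ℕ → H), (∀ k, R (z k) (z' k)) →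
      R (l.map z).prod (l.map z').prod := by
    intro l z z' h
    induction l with
    | nil => simpa using hone
    | cons k l ih => simpa using hmul (h k) ih
  have hF : ∀ y, R (genF X g n y) (genF X g' n (σ y)) := by
    intro y
    have hd : ∀ i, R (desc g n i y) (desc g' n i (σ y)) := fun i => hlist _ _ _ fun k => hf k y
    have ha : ∀ i, R (asc g n i y) (asc g' n i (σ y)) := fun i => hlist _ _ _ fun k => hf k y
    cases X
    · exact hone
    · exact hmul (hmul (hd 1) (hf 0 y)) (ha 1)
    · rw [genF, genF, pow_two, pow_two]
      exact hmul (hmul (hd 1) (hmul (hf 0 y) (hf 0 y))) (ha 1)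
    · exact hmul (hmul (hd 2) (hmul (hf 1 y) (hf 0 y))) (ha 2)
  exact hmul (hmul (hlist _ _ _ fun i => hlist _ _ _ fun k => hf k _) (hlist _ _ _ fun i => hF _))
    (hlist _ _ _ fun i => hlist _ _ _ fun k => hf k _)

section Truncation

variable {g : ℕ → H} {m n : ℕ}

theorem desc_truncate (hg : ∀ k ≥ m, g k = 0) (hn : m ≤ n) (i : ℕ) (y : A) :
    desc g n i y = desc g m i y := by
  induction n, hn using Nat.le_induction with
  | base => rfl
  | succ n hn ih =>
    rcases le_or_gt i n with h | h
    · rw [desc_top _ h, hg n hn, ih]; simp [factor]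
    · rw [desc_self _ _ _ (by omega), desc_self _ _ _ (by omega)]

theorem asc_truncate (hg : ∀ k ≥ m, g k = 0) (hn : m ≤ n) (i : ℕ) (y : A) :
    asc g n i y = asc g m i y := by
  induction n, hn using Nat.le_induction with
  | base => rfl
  | succ n hn ih =>
    rcases le_or_gt i n with h | h
    · rw [asc_top _ h, hg n hn, ih]; simp [factor]
    · rw [asc_self _ _ _ (by omega), asc_self _ _ _ (by omega)]

/-- If `g_k = 0` for `k ≥ m`, then `G_n^X = G_m^X` for `n ≥ m`. -/
theorem genG_truncate (hg : ∀ k ≥ m, g k = 0) (hm : 1 ≤ m) (hn : m ≤ n) (X : ClassicalType) (N : ℕ)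
    (a b x : ℕ → A) : genG X g n N a b x = genG X g m N a b x := by
  have hF : ∀ y : A, genF X g n y = genF X g m y := fun y => by
    cases X <;> simp only [genF, desc_truncate hg hn, asc_truncate hg hn]
  have hl : List.range' 1 (n - 1) = List.range' 1 (m - 1) ++ List.range' m (n - m) := by
    rw [show n - 1 = (m - 1) + (n - m) by omega, ← List.range'_append_1]
    congr 2
    omega
  have h1 : genGA g n a = genGA g m a := by
    simp only [genGA, desc_truncate hg hn, hl, List.map_append, List.prod_append]
    rw [List.prod_eq_one (l := (List.range' m (n - m)).map _), mul_one]
    intro z hz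
    obtain ⟨k, hk, rfl⟩ := List.mem_map.1 hz
    rw [List.mem_range'_1] at hk
    exact desc_self _ _ _ hk.1 _
  have h2 : genGAInv g n b = genGAInv g m b := by
    simp only [genGAInv, asc_truncate hg hn, hl, List.reverse_append, List.map_append,
      List.prod_append]
    rw [List.prod_eq_one (l := (List.range' m (n - m)).reverse.map _), one_mul]
    intro z hz
    obtain ⟨k, hk, rfl⟩ := List.mem_map.1 hz
    rw [List.mem_reverse, List.mem_range'_1] at hk
    exact asc_self _ _ _ hk.1 _
  simp only [genG, h1, h2, genBoldF, hF]

end Truncation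

section TypeA

variable {β : A} {g : ℕ → H}

theorem IsTypeA.genGA_mul_genGAInv (hg : IsTypeA β g) (n : ℕ) {p q : ℕ → A}
    (h : ∀ i, p i + q i + β * p i * q i = 0) : genGA g n p * genGAInv g n q = 1 := by
  have key : ∀ l : List ℕ, (∀ i ∈ l, 1 ≤ i) → (l.map fun i => desc g n i (p i)).prod *
      (l.reverse.map fun i => asc g n i (q i)).prod = 1 := by
    intro l hl
    induction l with
    | nil => simp
    | cons i l ih =>
      rw [List.forall_mem_cons] at hl
      simp only [List.map_cons, List.prod_cons, List.reverse_cons, List.map_append, List.map_nil,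
        List.prod_append, List.prod_nil, mul_one]
      rw [mul_assoc, ← mul_assoc _ _ (asc g n i (q i)), ih hl.2, one_mul,
        hg.desc_mul_asc (h i) n hl.1]
  exact key _ fun i hi => (List.mem_range'_1.1 hi).1

theorem IsTypeA.genGAInv_mul_genGA (hg : IsTypeA β g) (n : ℕ) {p q : ℕ → A}
    (h : ∀ i, p i + q i + β * p i * q i = 0) : genGAInv g n q * genGA g n p = 1 := by
  have key : ∀ l : List ℕ, (∀ i ∈ l, 1 ≤ i) → (l.reverse.map fun i => asc g n i (q i)).prod *
      (l.map fun i => desc g n i (p i)).prod = 1 := by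
    intro l hl
    induction l with
    | nil => simp
    | cons i l ih =>
      rw [List.forall_mem_cons] at hl
      simp only [List.map_cons, List.prod_cons, List.reverse_cons, List.map_append, List.map_nil,
        List.prod_append, List.prod_nil, mul_one]
      rw [mul_assoc, ← mul_assoc (asc g n i (q i)),
        hg.asc_mul_desc (by linear_combination h i) n hl.1, one_mul, ih hl.2]
  exact key _ fun i hi => (List.mem_range'_1.1 hi).1

theorem genGA_eq_range' (g : ℕ → H) {n : ℕ} (hn : 1 ≤ n) (p : ℕ → A) :
    genGA g n p = ((List.range' 1 n).map fun i => desc g n i (p i)).prod := by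
  rw [show n = n - 1 + 1 by omega, List.range'_concat]
  simp only [genGA, Nat.add_sub_cancel, List.map_append, List.prod_append, List.map_cons,
    List.map_nil, List.prod_cons, List.prod_nil, mul_one]
  rw [desc_self _ _ (1 + 1 * (n - 1)) (by omega), mul_one]

/-- The tail of a product `genGA` commutes with whatever commutes with `g_{i+1}, g_{i+2}, …`. -/
theorem commute_tail {z : H} {i : ℕ} (hz : ∀ k ≥ i, Commute z (g k)) (n r : ℕ) (p : ℕ → A) :
    Commute z ((List.range' i r).map fun l => desc g n l (p l)).prod := by
  refine Commute.list_prod_right _ _ fun w hw => ?_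
  obtain ⟨l, hl, rfl⟩ := List.mem_map.1 hw
  rw [List.mem_range'_1] at hl
  exact commute_desc (fun k hk => hz k (by omega)) n _

/-- Exchanging `a_i` and `a_{i+1}` in `G_{A_{n-1}}(a)` is right multiplication by
`h_i(a_{i+1} ⊖ a_i)`. -/
theorem IsTypeA.genGA_swap (hg : IsTypeA β g) {n i : ℕ} (hi : 1 ≤ i) (hin : i < n) (a : ℕ → A)
    {r : A} (hr : a (i + 1) = a i + r + β * a i * r) :
    genGA g n (fun k => a (Equiv.swap i (i + 1) k)) = genGA g n a * factor (g i) r := by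
  have hl : List.range' 1 n = List.range' 1 (i - 1) ++ i :: (i + 1) ::
      List.range' (i + 2) (n - i - 1) := by
    have h := List.range'_append_1 (s := 1) (m := i - 1) (n := n - i - 1 + 1 + 1)
    rw [show i - 1 + (n - i - 1 + 1 + 1) = n by omega, show 1 + (i - 1) = i by omega,
      List.range'_succ, List.range'_succ] at h
    exact h.symm
  rw [genGA_eq_range' _ (by omega), genGA_eq_range' _ (by omega), hl]
  simp only [List.map_append, List.prod_append, List.map_cons, List.prod_cons,
    Equiv.swap_apply_left, Equiv.swap_apply_right]
  have hc : Commute (factor (g i) r)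
      ((List.range' (i + 2) (n - i - 1)).map fun l => desc g n l (a l)).prod :=
    (Commute.one_left _).add_left
      ((commute_tail (fun k hk => hg.comm i hi k hk) n _ a).smul_left r)
  have h1 : (List.range' 1 (i - 1)).map (fun l => desc g n l (a (Equiv.swap i (i + 1) l)))
      = (List.range' 1 (i - 1)).map (fun l => desc g n l (a l)) := by
    refine List.map_congr_left fun l hl => ?_
    rw [List.mem_range'_1] at hl
    rw [Equiv.swap_apply_of_ne_of_ne (by omega) (by omega)]
  have h2 : (List.range' (i + 2) (n - i - 1)).map
        (fun l => desc g n l (a (Equiv.swap i (i + 1) l)))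
      = (List.range' (i + 2) (n - i - 1)).map (fun l => desc g n l (a l)) := by
    refine List.map_congr_left fun l hl => ?_
    rw [List.mem_range'_1] at hl
    rw [Equiv.swap_apply_of_ne_of_ne (by omega) (by omega)]
  rw [h1, h2, ← mul_assoc (desc g n i (a (i + 1))), ← hg.desc_exchange hr hi hin]
  simp only [mul_assoc]
  rw [hc.eq]

theorem genGA_split_one (g : ℕ → H) {n : ℕ} (hn : 1 ≤ n) (p : ℕ → A) :
    genGA g n p = desc g n 1 (p 1) *
      ((List.range' 2 (n - 1)).map fun i => desc g n i (p i)).prod := by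
  rw [genGA_eq_range' _ hn, show n = n - 1 + 1 by omega, List.range'_succ]
  simp

theorem genGA_split_two (g : ℕ → H) {n : ℕ} (hn : 2 ≤ n) (p : ℕ → A) :
    genGA g n p = desc g n 1 (p 1) * desc g n 2 (p 2) *
      ((List.range' 3 (n - 2)).map fun i => desc g n i (p i)).prod := by
  rw [genGA_eq_range' _ (by omega), show n = n - 2 + 1 + 1 by omega, List.range'_succ,
    List.range'_succ]
  simp [mul_assoc]

end TypeA

end GeneralProducts

/-! ### Relations in the idCoxeter algebra of a Weyl group -/

section WeylRelations

variable {A : Type*} [CommRing A] {I : Type*} {M : CoxeterMatrix I} {β : A}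

theorem u_sq (i : I) : u M β i * u M β i = β • u M β i := by
  have := RingQuot.mkAlgHom_rel A (IdRel.quadratic (M := M) (β := β) i)
  simpa [u] using this

theorem u_braid (i j : I) : ((CoxeterSystem.braidWord M i j).map (u M β)).prod
    = ((CoxeterSystem.braidWord M j i).map (u M β)).prod := by
  have := RingQuot.mkAlgHom_rel A (IdRel.braid (M := M) (β := β) i j)
  rw [map_list_prod, map_list_prod, List.map_map, List.map_map] at this
  exact this

open CoxeterSystem in
theorem u_commute {i j : I} (h : M i j = 2) : Commute (u M β i) (u M β j) := by
  have := u_braid (M := M) (β := β) i j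
  rw [braidWord, braidWord, M.symmetric j i, h] at this
  simpa [alternatingWord, Commute, SemiconjBy] using this

open CoxeterSystem in
theorem u_braid_three {i j : I} (h : M i j = 3) :
    u M β i * u M β j * u M β i = u M β j * u M β i * u M β j := by
  have := u_braid (M := M) (β := β) i j
  rw [braidWord, braidWord, M.symmetric j i, h] at this
  simpa [alternatingWord, mul_assoc] using this.symm

open CoxeterSystem in
theorem u_braid_four {i j : I} (h : M i j = 4) :
    u M β i * u M β j * u M β i * u M β j = u M β j * u M β i * u M β j * u M β i := by
  have := u_braid (M := M) (β := β) i j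
  rw [braidWord, braidWord, M.symmetric j i, h] at this
  simpa [alternatingWord, mul_assoc] using this

theorem coxeterMatrix_of_lt (X : ClassicalType) {i j : ℕ} (h : i < j) :
    coxeterMatrix X i j = bond X i j := by
  change (if i = j then 1 else bond X (min i j) (max i j)) = _
  rw [if_neg h.ne, min_eq_left h.le, max_eq_right h.le]

theorem node_label (X : ClassicalType) (j : ℕ) : node X (label X j) = j := by
  cases X <;> simp [node, label]

theorem label_node (X : ClassicalType) {k : ℕ} (hk : 1 ≤ k) : label X (node X k) = k := by
  cases X <;> simp [node, label]; omega

/-- The generators of the idCoxeter algebra of `W(X)`, indexed by the names of the simple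
reflections. -/
noncomputable def gen (X : ClassicalType) (k : ℕ) : IdAlg X :=
  u (coxeterMatrix X) beta (node X k)

theorem gen_sq (X : ClassicalType) (k : ℕ) : gen X k * gen X k = beta • gen X k := u_sq _

theorem gen_isTypeA (X : ClassicalType) : IsTypeA beta (gen X) where
  sq k _ := gen_sq X k
  comm k hk l hl := by
    refine u_commute ?_
    rw [coxeterMatrix_of_lt]
    · cases X <;> grind [bond, node]
    · cases X <;> simp only [node] <;> omega
  braid k hk := by
    refine u_braid_three ?_
    rw [coxeterMatrix_of_lt]
    · cases X <;> grind [bond, node]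
    · cases X <;> simp only [node] <;> omega

theorem gen_forkChain : IsTypeA beta (forkChain (gen .D)) :=
  (gen_isTypeA .D).forkChain (gen_sq _ _)
    (fun k hk => u_commute (by rw [coxeterMatrix_of_lt] <;> grind [bond, node]))
    (u_braid_three (by rw [coxeterMatrix_of_lt] <;> simp [bond, node]))

theorem gen_one_commute_zero : Commute (gen .D 1) (gen .D 0) :=
  (u_commute (by rw [coxeterMatrix_of_lt] <;> simp [bond, node])).symm

theorem gen_zero_commute {X : ClassicalType} (hX : X ≠ .A) {k : ℕ} (hk : 3 ≤ k) :
    Commute (gen X 0) (gen X k) := by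
  refine u_commute ?_
  rw [coxeterMatrix_of_lt]
  · cases X <;> grind [bond, node]
  · cases X <;> simp only [node] <;> omega

theorem gen_zero_commute_BC {X : ClassicalType} (hX : X = .B ∨ X = .C) {k : ℕ} (hk : 2 ≤ k) :
    Commute (gen X 0) (gen X k) := by
  refine u_commute ?_
  rcases hX with rfl | rfl <;> rw [coxeterMatrix_of_lt] <;> grind [bond, node]

theorem gen_braid_four {X : ClassicalType} (hX : X = .B ∨ X = .C) :
    gen X 0 * gen X 1 * gen X 0 * gen X 1 = gen X 1 * gen X 0 * gen X 1 * gen X 0 := by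
  refine u_braid_four ?_
  rcases hX with rfl | rfl <;> rw [coxeterMatrix_of_lt] <;> simp [bond, node]

open MvPowerSeries in
/-- The elements `F_n^X(x)` and `F_n^X(y)` commute. -/
theorem genF_commute (X : ClassicalType) {n : ℕ} (hn : 2 ≤ n) {x y : Ser}
    (hy : constantCoeff y = 0) :
    Commute (genF X (gen X) n x) (genF X (gen X) n y) := by
  -- the parameters `p = x ⊖ y` and `q = x ⊕ y` of the reflection equation
  obtain ⟨p, hp⟩ : ∃ p, x = p + y + beta * p * y :=
    ⟨oplus x (bar y), by
      unfold oplus; linear_combination (-(1 + beta * x)) * oplus_bar hy⟩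
  obtain ⟨q, hq⟩ : ∃ q, q = x + y + beta * x * y := ⟨_, rfl⟩
  have hA := gen_isTypeA X
  have hcf : ∀ {z : IdAlg X} {k : ℕ} (t : Ser), Commute z (gen X k) → Commute (factor z t) (gen X k) :=
    fun t h => (Commute.one_left _).add_left (h.smul_left t)
  have hself : ∀ (k : ℕ) (s t : Ser), Commute (factor (gen X k) s) (factor (gen X k) t) :=
    fun k s t => factor_commute (Commute.refl _) s t
  cases X with
  | A => exact Commute.one_left _
  | B =>
    exact hA.commute_sandwich le_rfl hp hq
      (fun k hk => hcf _ (gen_zero_commute_BC (Or.inl rfl) hk))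
      (fun k hk => hcf _ (gen_zero_commute_BC (Or.inl rfl) hk))
      (yangBaxter_four (gen_sq _ 0) (gen_sq _ 1) (gen_braid_four (Or.inl rfl)) hp hq
        (Or.inl ⟨rfl, rfl⟩)) (hself 0 x y) (by omega)
  | C =>
    simp only [genF, pow_two, factor_mul_factor (gen_sq .C 0)]
    exact hA.commute_sandwich le_rfl hp hq
      (fun k hk => hcf _ (gen_zero_commute_BC (Or.inr rfl) hk))
      (fun k hk => hcf _ (gen_zero_commute_BC (Or.inr rfl) hk))
      (yangBaxter_four (gen_sq _ 0) (gen_sq _ 1) (gen_braid_four (Or.inr rfl)) hp hq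
        (Or.inr ⟨rfl, rfl⟩)) (hself 0 _ _) (by omega)
  | D =>
    have h01 : ∀ s t : Ser, Commute (factor (gen .D 1) s) (factor (gen .D 0) t) :=
      fun s t => factor_commute gen_one_commute_zero s t
    exact hA.commute_sandwich (by omega) hp hq
      (fun k hk => (hcf _ (hA.comm 1 le_rfl k hk)).mul_left
        (hcf _ (gen_zero_commute (by simp) hk)))
      (fun k hk => (hcf _ (hA.comm 1 le_rfl k hk)).mul_left
        (hcf _ (gen_zero_commute (by simp) hk)))
      (typeD_reflection hA gen_forkChain gen_one_commute_zero hp hq)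
      (((hself 1 x y).mul_right (h01 x y)).mul_left ((h01 y x).symm.mul_right (hself 0 x y))) hn

end WeylRelations

/-! ### Parabolic subgroups of the Weyl group -/

section Parabolic

theorem mem_of_mem_rightInvSeq {I W : Type*} [Group W] {M : CoxeterMatrix I}
    (cs : CoxeterSystem M W) {S : Subgroup W} {ω : List I} (hω : ∀ i ∈ ω, cs.simple i ∈ S) {t : W}
    (ht : t ∈ cs.rightInvSeq ω) : t ∈ S := by
  have hprod : ∀ ω : List I, (∀ i ∈ ω, cs.simple i ∈ S) → cs.wordProd ω ∈ S := by
    intro ω h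
    refine S.list_prod_mem fun x hx => ?_
    obtain ⟨i, hi, rfl⟩ := List.mem_map.1 hx
    exact h i hi
  induction ω with
  | nil => simp at ht
  | cons i ω ih =>
    rw [List.forall_mem_cons] at hω
    rw [CoxeterSystem.rightInvSeq, List.mem_cons] at ht
    rcases ht with rfl | ht
    · exact S.mul_mem (S.mul_mem (S.inv_mem (hprod ω hω.2)) hω.1) (hprod ω hω.2)
    · exact ih hω.2 ht

/-- The permutation of `ℕ` underlying the signed permutation by which a simple reflection acts
(all signs are forgotten). -/
def shadow : ClassicalType → ℕ → Equiv.Perm ℕ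
  | .D, 0 => Equiv.swap 1 2
  | .A, j => Equiv.swap (j + 1) (j + 2)
  | _, 0 => 1
  | _, j + 1 => Equiv.swap (j + 1) (j + 2)

theorem swap_mul_swap_pow_three (i : ℕ) :
    (Equiv.swap i (i + 1) * Equiv.swap (i + 1) (i + 2)) ^ 3 = 1 := by
  have h1 := Equiv.swap_mul_swap_mul_swap (x := i + 2) (y := i + 1) (z := i)
    (by omega) (by omega)
  have h2 := Equiv.swap_mul_swap_mul_swap (x := i) (y := i + 1) (z := i + 2)
    (by omega) (by omega)
  rw [Equiv.swap_comm (i + 1) i, Equiv.swap_comm (i + 2) (i + 1)] at h1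
  calc _ = (Equiv.swap i (i + 1) * Equiv.swap (i + 1) (i + 2) * Equiv.swap i (i + 1)) *
        (Equiv.swap (i + 1) (i + 2) * Equiv.swap i (i + 1) * Equiv.swap (i + 1) (i + 2)) := by
        simp only [pow_succ, pow_zero, one_mul, mul_assoc]
    _ = 1 := by rw [h1, h2, Equiv.swap_comm, Equiv.swap_mul_self]

theorem swap_mul_swap_sq {i j : ℕ} (h : i + 2 ≤ j) :
    (Equiv.swap i (i + 1) * Equiv.swap j (j + 1)) ^ 2 = 1 := by
  have hc : Commute (Equiv.swap i (i + 1)) (Equiv.swap j (j + 1)) := by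
    refine (Equiv.Perm.disjoint_swap_swap ?_).commute
    simp
    omega
  rw [hc.mul_pow, pow_two, pow_two, Equiv.swap_mul_self, Equiv.swap_mul_self, one_mul]

theorem shadow_mul_self (X : ClassicalType) (j : ℕ) : shadow X j * shadow X j = 1 := by
  cases X <;> cases j <;> simp [shadow]

theorem shadow_pow_bond (X : ClassicalType) {i j : ℕ} (h : i < j) :
    (shadow X i * shadow X j) ^ bond X i j = 1 := by
  obtain ⟨j, rfl⟩ : ∃ k, j = k + 1 := ⟨j - 1, by omega⟩
  have key : ∀ i j : ℕ, i < j → ∀ m, (if j = i + 1 then 3 else 2) = m →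
      (Equiv.swap i (i + 1) * Equiv.swap j (j + 1)) ^ m = 1 := by
    rintro i j hij m rfl
    split_ifs with e
    · subst e; exact swap_mul_swap_pow_three i
    · exact swap_mul_swap_sq (by omega)
  rcases i with _ | i
  · cases X with
    | A => exact key 1 (j + 2) (by omega) _ (by grind [bond])
    | B | C =>
      simp only [shadow, one_mul]
      have h2 : ∃ k, bond .B 0 (j + 1) = 2 * k := by
        by_cases hj : j = 0
        · exact ⟨2, by grind [bond]⟩
        · exact ⟨1, by grind [bond]⟩
      obtain ⟨k, hk⟩ := h2
      first | rw [hk] | rw [show bond .C 0 (j + 1) = 2 * k from hk]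
      rw [pow_mul, pow_two, Equiv.swap_mul_self, one_pow]
    | D =>
      rcases j with _ | j
      · simp [shadow, bond]
      · exact key 1 (j + 2) (by omega) _ (by grind [bond])
  · cases X with
    | A => exact key (i + 2) (j + 2) (by omega) _ (by grind [bond])
    | B | C | D => exact key (i + 1) (j + 1) (by omega) _ (by grind [bond])

theorem shadow_liftable (X : ClassicalType) : (coxeterMatrix X).IsLiftable (shadow X) := by
  intro i j
  rcases lt_trichotomy i j with h | rfl | h
  · rw [coxeterMatrix_of_lt X h]
    exact shadow_pow_bond X h
  · rw [shadow_mul_self, one_pow]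
  · have hinv : ∀ j, (shadow X j)⁻¹ = shadow X j := fun j =>
      inv_eq_of_mul_eq_one_right (shadow_mul_self X j)
    rw [(coxeterMatrix X).symmetric, coxeterMatrix_of_lt X h, ← inv_inj, ← inv_pow, mul_inv_rev,
      hinv, hinv, inv_one]
    exact shadow_pow_bond X h

/-- The action of `W(X)` on `ℕ` by unsigned permutations. -/
noncomputable def shadowHom (X : ClassicalType) : Weyl X →* Equiv.Perm ℕ :=
  (weylSystem X).lift ⟨shadow X, shadow_liftable X⟩

theorem shadowHom_simple (X : ClassicalType) (j : ℕ) :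
    shadowHom X ((weylSystem X).simple j) = shadow X j :=
  (weylSystem X).lift_apply_simple (shadow_liftable X) j

/-- The parabolic subgroup of `W(X)` generated by the simple reflections with names less
than `m`. -/
def parabolic (X : ClassicalType) (m : ℕ) : Subgroup (Weyl X) :=
  Subgroup.closure {w | ∃ j, label X j < m ∧ (weylSystem X).simple j = w}

theorem simple_mem_parabolic {X : ClassicalType} {m j : ℕ} (h : label X j < m) :
    (weylSystem X).simple j ∈ parabolic X m := Subgroup.subset_closure ⟨j, h, rfl⟩

/-- A simple reflection outside of the generating set is not in the parabolic subgroup: the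
subgroup fixes the points greater than `m`. -/
theorem simple_notMem_parabolic {X : ClassicalType} {m j : ℕ} (hm : 2 ≤ m) (h : m ≤ label X j) :
    (weylSystem X).simple j ∉ parabolic X m := by
  intro hj
  have fix : ∀ w ∈ parabolic X m, ∀ k > m, shadowHom X w k = k := by
    intro w hw
    induction hw using Subgroup.closure_induction with
    | mem w hw =>
      obtain ⟨i, hi, rfl⟩ := hw
      intro k hk
      rw [shadowHom_simple]
      cases X <;> cases i <;> simp only [shadow, label] at hi ⊢ <;> first
        | rfl
        | exact Equiv.swap_apply_of_ne_of_ne (by omega) (by omega)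
    | one => simp
    | mul a b _ _ ha hb => intro k hk; rw [map_mul, Equiv.Perm.mul_apply, hb k hk, ha k hk]
    | inv a _ ha => intro k hk; rw [map_inv, Equiv.Perm.inv_eq_iff_eq, ha k hk]
  have h1 := fix _ hj (label X j + 1) (by omega)
  rw [shadowHom_simple] at h1
  cases X <;> cases j <;> simp [shadow, label] at h h1 <;> omega

theorem exists_word_of_mem_parabolic {X : ClassicalType} {m : ℕ} {w : Weyl X}
    (hw : w ∈ parabolic X m) :
    ∃ ω : List ℕ, (∀ j ∈ ω, label X j < m) ∧ (weylSystem X).wordProd ω = w := by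
  induction hw using Subgroup.closure_induction with
  | mem w hw =>
    obtain ⟨i, hi, rfl⟩ := hw
    exact ⟨[i], by simpa using hi, by simp⟩
  | one => exact ⟨[], by simp, by simp⟩
  | mul a b _ _ ha hb =>
    obtain ⟨ω, h, rfl⟩ := ha
    obtain ⟨π, h', rfl⟩ := hb
    refine ⟨ω ++ π, fun j hj => ?_, (weylSystem X).wordProd_append _ _⟩
    rcases List.mem_append.1 hj with hj | hj
    exacts [h j hj, h' j hj]
  | inv a _ ha =>
    obtain ⟨ω, h, rfl⟩ := ha
    exact ⟨ω.reverse, fun j hj => h j (List.mem_reverse.1 hj), (weylSystem X).wordProd_reverse _⟩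

theorem not_leftDescent_of_mem_parabolic {X : ClassicalType} {m j : ℕ} (hm : 2 ≤ m)
    (h : m ≤ label X j) {w : Weyl X} (hw : w ∈ parabolic X m) :
    ¬ (weylSystem X).length ((weylSystem X).simple j * w) < (weylSystem X).length w := by
  intro hl
  obtain ⟨ω, hω, e⟩ := exists_word_of_mem_parabolic ((parabolic X m).inv_mem hw)
  have hl' : (weylSystem X).length ((weylSystem X).wordProd ω * (weylSystem X).simple j)
      < (weylSystem X).length ((weylSystem X).wordProd ω) := by
    rw [e, (weylSystem X).length_inv, ← (weylSystem X).length_inv]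
    simpa using hl
  exact simple_notMem_parabolic hm h (mem_of_mem_rightInvSeq (weylSystem X)
    (fun i hi => simple_mem_parabolic (hω i hi))
    (strong_exchange _ ((weylSystem X).isReflection_simple j) ω hl'))

theorem label_le (X : ClassicalType) (j : ℕ) : label X j ≤ j + 1 := by
  cases X <;> simp [label]

open Filter in
theorem eventually_mem_parabolic {X : ClassicalType} (w : Weyl X) :
    ∀ᶠ m in atTop, w ∈ parabolic X m := by
  induction w using (weylSystem X).simple_induction_left with
  | one => exact Eventually.of_forall fun m => one_mem _
  | mul_simple_left w j h =>
    filter_upwards [h, eventually_gt_atTop (j + 1)] with m hm hj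
    exact mul_mem (simple_mem_parabolic ((label_le X j).trans_lt hj)) hm

end Parabolic

/-! ### Coefficients of the products `G_n^X` -/

section Coefficients

variable {X : ClassicalType}

theorem regularRep_factor_apply (k : ℕ) (y : Ser) (v : Weyl X →₀ Ser) :
    regularRep (weylSystem X) beta (factor (gen X k) y) v
      = v + y • leftOp (weylSystem X) beta (node X k) v := by
  rw [factor, map_add, map_one, map_smul, gen, regularRep_u]
  rfl

/-- Two elements of the idCoxeter algebra agree on a parabolic subgroup if they act in the same way
on the coefficients at the elements of this subgroup. -/
def AgreeOn (m : ℕ) (z z' : IdAlg X) : Prop :=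
  ∀ v v' : Weyl X →₀ Ser, (∀ w ∈ parabolic X m, v w = v' w) → ∀ w ∈ parabolic X m,
    regularRep (weylSystem X) beta z v w = regularRep (weylSystem X) beta z' v' w

/-- The generators with names less than `m`, and zero in place of the other ones. -/
noncomputable def truncGen (X : ClassicalType) (m k : ℕ) : IdAlg X := if k < m then gen X k else 0

theorem agreeOn_factor {m : ℕ} (hm : 2 ≤ m) (k : ℕ) (y : Ser) :
    AgreeOn m (factor (gen X k) y) (factor (truncGen X m k) y) := by
  intro v v' h w hw
  rw [regularRep_factor_apply]
  rcases lt_or_ge k m with hk | hk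
  · have hl : label X (node X k) < m := by
      rcases Nat.eq_zero_or_pos k with rfl | h0
      · have := label_le X (node X 0)
        cases X <;> simp [label, node] <;> omega
      · rwa [label_node X h0]
    rw [truncGen, if_pos hk, regularRep_factor_apply]
    simp only [Finsupp.add_apply, Finsupp.smul_apply, leftOp_apply]
    rw [h w hw, h _ (mul_mem (simple_mem_parabolic hl) hw)]
  · rw [truncGen, if_neg (by omega)]
    have := not_leftDescent_of_mem_parabolic (j := node X k) hm
      (by rwa [label_node X (by omega)]) hw
    simp only [factor, smul_zero, add_zero, map_one, Finsupp.add_apply, Finsupp.smul_apply,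
      leftOp_apply, if_neg this, Module.End.one_apply]
    exact h w hw

theorem AgreeOn.mul {m : ℕ} {z z' y y' : IdAlg X} (h : AgreeOn m z z') (h' : AgreeOn m y y') :
    AgreeOn m (z * y) (z' * y') := by
  intro v v' hv w hw
  rw [map_mul, map_mul, Module.End.mul_apply, Module.End.mul_apply]
  exact h _ _ (h' v v' hv) w hw

/-- Only the generators with names less than `m` matter for the coefficients at the elements
of the parabolic subgroup. -/
theorem coeffU_genG_truncate {m n : ℕ} (hm : 2 ≤ m) (hn : m ≤ n) {w : Weyl X}
    (hw : w ∈ parabolic X m) (N : ℕ) (a b x : ℕ → Ser) :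
    coeffU (weylSystem X) beta w (genG X (gen X) n N a b x)
      = coeffU (weylSystem X) beta w (genG X (gen X) m N a b x) := by
  have key : ∀ n, AgreeOn m (genG X (gen X) n N a b x) (genG X (truncGen X m) n N a b x) :=
    fun n => genG_rel (σ := id) (fun _ _ h => by simpa using h) AgreeOn.mul
      (agreeOn_factor hm) X n N a b x
  have htr := genG_truncate (g := truncGen X m) (fun k hk => if_neg (by omega)) (by omega) hn X N
    a b x
  rw [coeffU, key n _ _ (fun _ _ => rfl) w hw, htr, ← key m _ _ (fun _ _ => rfl) w hw]
  rfl

/-- An endomorphism `σ` of the coefficient ring carries the action of one element of the idCoxeter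
algebra to the action of another one. -/
def Intertwines (σ : Ser →+* Ser) (z z' : IdAlg X) : Prop :=
  ∀ v : Weyl X →₀ Ser, (regularRep (weylSystem X) beta z v).mapRange σ σ.map_zero
    = regularRep (weylSystem X) beta z' (v.mapRange σ σ.map_zero)

theorem Intertwines.mul {σ : Ser →+* Ser} {z z' y y' : IdAlg X} (h : Intertwines σ z z')
    (h' : Intertwines σ y y') : Intertwines σ (z * y) (z' * y') := by
  intro v
  rw [map_mul, map_mul, Module.End.mul_apply, Module.End.mul_apply, h, h']

theorem intertwines_factor {σ : Ser →+* Ser} (hσ : σ beta = beta) (k : ℕ) (y : Ser) :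
    Intertwines σ (factor (gen X k) y) (factor (gen X k) (σ y)) := by
  intro v
  ext1 w
  rw [regularRep_factor_apply, regularRep_factor_apply]
  simp only [Finsupp.mapRange_apply, Finsupp.add_apply, Finsupp.smul_apply, leftOp_apply,
    smul_eq_mul, map_add, map_mul]
  split_ifs <;> simp [hσ]

theorem map_coeffU_genG {σ : Ser →+* Ser} (hσ : σ beta = beta) (n N : ℕ) (a b x : ℕ → Ser)
    (w : Weyl X) :
    σ (coeffU (weylSystem X) beta w (genG X (gen X) n N a b x))
      = coeffU (weylSystem X) beta w
        (genG X (gen X) n N (fun i => σ (a i)) (fun i => σ (b i)) (fun i => σ (x i))) := by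
  have hone : Intertwines (X := X) σ 1 1 := fun v => by
    rw [map_one, Module.End.one_apply, Module.End.one_apply]
  have h : Intertwines σ (genG X (gen X) n N a b x) _ :=
    genG_rel (σ := σ) hone Intertwines.mul (intertwines_factor hσ) X n N a b x
  have := DFunLike.congr_fun (h (Finsupp.single 1 1)) w
  rw [Finsupp.mapRange_apply, Finsupp.mapRange_single, map_one] at this
  exact this

theorem coeffU_add (w : Weyl X) (z z' : IdAlg X) : coeffU (weylSystem X) beta w (z + z')
    = coeffU (weylSystem X) beta w z + coeffU (weylSystem X) beta w z' := by
  simp [coeffU]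

theorem coeffU_smul (w : Weyl X) (r : Ser) (z : IdAlg X) : coeffU (weylSystem X) beta w (r • z)
    = r * coeffU (weylSystem X) beta w z := by
  simp [coeffU]

end Coefficients

/-! ### Existence of the limit -/

section Limit

open MvPowerSeries Filter

variable (X : ClassicalType)

/-- `G_n^X(a, b; x)` with `N` variables `x`. -/
noncomputable def doubleG (n N : ℕ) : IdAlg X := genG X (gen X) n N va vb vx

theorem G_eq_doubleG (n : ℕ) : G X n = doubleG X n n := by
  have hF : ∀ y, F X n y = genF X (gen X) n y := fun y => by cases X <;> rfl
  have h1 : boldF X n = genBoldF X (gen X) n n vx := by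
    simp only [boldF, genBoldF, hF, List.range'_eq_map_range, List.map_map, Function.comp_def,
      add_comm 1]
  have h2 : ∀ i, bar (vb i) + vb i + beta * bar (vb i) * vb i = 0 := fun i => by
    linear_combination oplus_bar (constantCoeff_vb i)
  have h3 : Ring.inverse (GA X n fun i => bar (vb i)) = genGAInv (gen X) n vb := by
    exact Ring.inverse_unit ⟨GA X n fun i => bar (vb i), genGAInv (gen X) n vb,
      (gen_isTypeA X).genGA_mul_genGAInv n h2, (gen_isTypeA X).genGAInv_mul_genGA n h2⟩
  rw [G, h1, h3]
  rfl

/-- The factor `F_n^X(x_{N+1})` is congruent to `1` modulo `x_{N+1}`. -/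
theorem coeff_doubleG_succ (n N : ℕ) (w : Weyl X) {d : Var →₀ ℕ} (hd : d (Var.x (N + 1)) = 0) :
    coeff d (coeffU (weylSystem X) beta w (doubleG X n (N + 1)))
      = coeff d (coeffU (weylSystem X) beta w (doubleG X n N)) := by
  obtain ⟨T, hT⟩ := genF_eq_one_add X (gen X) n (vx (N + 1))
  have e : doubleG X n (N + 1) = doubleG X n N +
      vx (N + 1) • (genGAInv (gen X) n vb * genBoldF X (gen X) n N vx * T * genGA (gen X) n va) := by
    rw [doubleG, doubleG, genG, genG, genBoldF_succ, hT]
    simp only [mul_add, add_mul, mul_one, mul_smul_comm, smul_mul_assoc, mul_assoc]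
  rw [e, coeffU_add, coeffU_smul, map_add, add_eq_left]
  exact X_dvd_iff.1 (dvd_mul_right _ _) d hd

theorem exists_isLimit_doubleG (n : ℕ) (w : Weyl X) :
    ∃ f, IsLimit (fun N => coeffU (weylSystem X) beta w (doubleG X n N)) f := by
  have key : ∀ d : Var →₀ ℕ, ∃ N₀, ∀ N ≥ N₀,
      coeff d (coeffU (weylSystem X) beta w (doubleG X n N))
        = coeff d (coeffU (weylSystem X) beta w (doubleG X n N₀)) := by
    intro d
    refine ⟨d.support.sup Var.index, fun N hN => ?_⟩
    induction N, hN using Nat.le_induction with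
    | base => rfl
    | succ N hN ih =>
      rw [coeff_doubleG_succ, ih]
      by_contra h
      have := Finset.le_sup (f := Var.index) (Finsupp.mem_support_iff.2 h)
      simp only [Var.index] at this
      omega
  choose N₀ hN₀ using key
  refine ⟨fun d => coeff d (coeffU (weylSystem X) beta w (doubleG X n (N₀ d))), fun d => ?_⟩
  filter_upwards [eventually_ge_atTop (N₀ d)] with N hN
  exact hN₀ d N hN

variable {X}

theorem isLimit_grothN_and_doubleG {m : ℕ} (hm : 2 ≤ m) {w : Weyl X} (hw : w ∈ parabolic X m) :
    IsLimit (fun n => grothN X n w) (groth X w) ∧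
      IsLimit (fun N => coeffU (weylSystem X) beta w (doubleG X m N)) (groth X w) := by
  obtain ⟨f, hf⟩ := exists_isLimit_doubleG X m w
  have hf' : IsLimit (fun n => grothN X n w) f := by
    refine hf.congr ?_
    filter_upwards [eventually_ge_atTop m] with n hn
    rw [grothN, G_eq_doubleG]
    exact (coeffU_genG_truncate hm hn hw n va vb vx).symm
  have hex : ∃ f, IsLimit (fun n => grothN X n w) f := ⟨f, hf'⟩
  have hg : IsLimit (fun n => grothN X n w) (groth X w) := by
    rw [groth, dif_pos hex]
    exact hex.choose_spec
  exact ⟨hg, by rwa [hg.unique hf']⟩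

theorem isLimit_groth (w : Weyl X) : IsLimit (fun n => grothN X n w) (groth X w) := by
  obtain ⟨m, hw, hm⟩ := ((eventually_mem_parabolic w).and (eventually_ge_atTop 2)).exists
  exact (isLimit_grothN_and_doubleG hm hw).1

/-- On a parabolic subgroup `𝒢_w` is the limit of the coefficients of `G_m^X` with `m` fixed, as
the number of the variables `x` grows. -/
theorem isLimit_doubleG {m : ℕ} (hm : 2 ≤ m) {w : Weyl X} (hw : w ∈ parabolic X m) :
    IsLimit (fun N => coeffU (weylSystem X) beta w (doubleG X m N)) (groth X w) :=
  (isLimit_grothN_and_doubleG hm hw).2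

end Limit

/-! ### Divided differences of the double Grothendieck polynomials -/

section Reflection

open MvPowerSeries Filter

theorem constantCoeff_root (X : ClassicalType) (j : ℕ) :
    constantCoeff (root X (label X j)) = 0 := by
  have ha := constantCoeff_va
  have hb := fun i => constantCoeff_bar (ha i)
  exact match X, j with
    | .A, _ | .B, _ + 1 | .C, _ + 1 | .D, _ + 1 => constantCoeff_oplus (ha _) (hb _)
    | .B, 0 => hb 1
    | .C, 0 => constantCoeff_oplus (hb 1) (hb 1)
    | .D, 0 => constantCoeff_oplus (hb 1) (hb 2)

theorem va_succ_eq (i : ℕ) : va (i + 2) = va (i + 1) + bar (oplus (va (i + 1)) (bar (va (i + 2))))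
    + beta * va (i + 1) * bar (oplus (va (i + 1)) (bar (va (i + 2)))) := by
  have h1 := oplus_bar (constantCoeff_va (i + 2))
  have h2 := oplus_bar (constantCoeff_oplus (constantCoeff_va (i + 1))
    (constantCoeff_bar (constantCoeff_va (i + 2))))
  set r := bar (oplus (va (i + 1)) (bar (va (i + 2)))) with hr
  unfold oplus at h2
  -- `a ⊕ r = a ⊕ r ⊕ (a' ⊕ ā') = (a ⊕ ā' ⊕ r) ⊕ a' = a'`
  linear_combination (1 + beta * (va (i + 1) + r + beta * va (i + 1) * r)) * h1 -
    (1 + beta * va (i + 2)) * h2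

theorem bar_oplus_bar (i j : ℕ) : bar (oplus (bar (va i)) (bar (va j))) = oplus (va i) (va j) := by
  have h1 := oplus_bar (constantCoeff_va i)
  have h2 := oplus_bar (constantCoeff_va j)
  refine bar_eq_of_oplus_eq_zero (constantCoeff_oplus (constantCoeff_bar (constantCoeff_va i))
    (constantCoeff_bar (constantCoeff_va j))) ?_
  unfold oplus
  linear_combination h1 + (1 + beta * (va i + bar (va i) + beta * va i * bar (va i))) * h2

theorem X_not_dvd_X {s t : Var} (h : s ≠ t) :
    ¬ (MvPowerSeries.X s : Ser) ∣ MvPowerSeries.X t := by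
  classical
  intro hd
  have := X_dvd_iff.1 hd (Finsupp.single t 1) (by simp [h.symm])
  simp [coeff_X] at this

theorem root_ne_zero (X : ClassicalType) (j : ℕ) : root X (label X j) ≠ 0 := by
  have hX : ∀ i, va i ≠ 0 := fun i h => X_not_dvd_X (s := .b 0) (t := .a i) (by simp)
    (by change _ ∣ va i; rw [h]; exact dvd_zero _)
  have hpos : ∀ i, oplus (va (i + 1)) (bar (va (i + 2))) ≠ 0 := by
    intro i h
    have := va_succ_eq i
    rw [h, bar_zero, add_zero, mul_zero, add_zero] at this
    exact X_not_dvd_X (s := .a (i + 2)) (t := .a (i + 1)) (by simp) (dvd_of_eq this)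
  have hbar : bar (va 1) ≠ 0 := fun h => hX 1 (by
    rw [← bar_bar (constantCoeff_va 1), h, bar_zero])
  have hC : oplus (bar (va 1)) (bar (va 1)) ≠ 0 := by
    intro h
    have h1 := bar_oplus_bar 1 1
    rw [h, bar_zero] at h1
    have h2 : va 1 * (2 + beta * va 1) = 0 := by rw [oplus] at h1; linear_combination -h1
    rcases mul_eq_zero.1 h2 with h2 | h2
    · exact hX 1 h2
    · have := congrArg (constantCoeff (σ := Var) (R := Polynomial ℤ)) h2
      rw [map_add, map_mul, constantCoeff_va, mul_zero, add_zero, map_ofNat, map_zero] at this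
      exact two_ne_zero this
  have hD : oplus (bar (va 1)) (bar (va 2)) ≠ 0 := by
    intro h
    have h1 := bar_oplus_bar 1 2
    rw [h, bar_zero] at h1
    refine X_not_dvd_X (s := .a 2) (t := .a 1) (by simp) ⟨-(1 + beta * va 1), ?_⟩
    change va 1 = va 2 * _
    rw [oplus] at h1
    linear_combination -h1
  exact match X, j with
    | .A, _ | .B, _ + 1 | .C, _ + 1 | .D, _ + 1 => hpos _
    | .B, 0 => hbar
    | .C, 0 => hC
    | .D, 0 => hD

/-- The action of `s_i^{(a)}` as a ring endomorphism. -/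
noncomputable def reflHom (X : ClassicalType) (i : ℕ) : Ser →+* Ser :=
  substHom (hasSubst_reflVar X i)

theorem reflHom_apply (X : ClassicalType) (i : ℕ) (f : Ser) : reflHom X i f = refl X i f :=
  substHom_apply _ f

theorem reflHom_beta (X : ClassicalType) (i : ℕ) : reflHom X i beta = beta := substHom_beta _

theorem reflHom_X (X : ClassicalType) (i : ℕ) (t : Var) :
    reflHom X i (MvPowerSeries.X t) = reflVar X i t := substHom_X _ t

/-- The reflection `s_0` (or `s_{1̂}`) multiplies `G_n^X(a, b; x)` on the right by
`h_0(ᾱ_0(a))`. It uses up `k` of the variables `x`. -/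
theorem genG_special_reflection {X : ClassicalType} (hX : X ≠ .A) {n : ℕ} (hn : 2 ≤ n) :
    ∃ k, ∀ N, genG X (gen X) n (N + k) (fun i => reflVar X 0 (.a i)) (fun i => reflVar X 0 (.b i))
        (fun i => reflVar X 0 (.x i)) = doubleG X n N * factor (gen X 0) (bar (root X 0)) := by
  have hA := gen_isTypeA X
  have hF : ∀ (N : ℕ) (y : Ser), Commute (genF X (gen X) n y) (genBoldF X (gen X) n N vx) :=
    fun N y => Commute.list_prod_right _ _ fun z hz => by
      obtain ⟨i, -, rfl⟩ := List.mem_map.1 hz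
      exact genF_commute X hn (constantCoeff_vx _)
  have ha := fun i => oplus_bar (constantCoeff_va i)
  cases X with
  | A => exact absurd rfl hX
  | B =>
    refine ⟨1, fun N => ?_⟩
    have h1 : genBoldF .B (gen .B) n (N + 1) (fun i => reflVar .B 0 (.x i))
        = genBoldF .B (gen .B) n N vx * genF .B (gen .B) n (va 1) := by
      rw [genBoldF_succ', ← (hF N (va 1)).eq]
      exact congrArg _ (genBoldF_congr _ _ _ _ fun i => rfl)
    have hc := commute_tail (A := Ser) (z := factor (gen .B 0) (va 1)) (g := gen .B) (i := 2)
      (fun k hk => (Commute.one_left _).add_left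
        ((gen_zero_commute_BC (Or.inl rfl) hk).smul_left _)) n (n - 1) va
    have h2 : genF .B (gen .B) n (va 1) * genGA (gen .B) n (fun i => reflVar .B 0 (.a i))
        = genGA (gen .B) n va * factor (gen .B 0) (va 1) := by
      rw [genGA_split_one _ (by omega), genGA_split_one _ (by omega), mul_assoc, ← hc.eq,
        ← mul_assoc, ← mul_assoc, genF]
      change desc (gen .B) n 1 (va 1) * factor (gen .B 0) (va 1) * asc (gen .B) n 1 (va 1) *
        desc (gen .B) n 1 (bar (va 1)) * _ = _
      rw [hA.sandwich_mul_desc (ha 1)]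
      congr 2
      refine List.map_congr_left fun l hl => ?_
      obtain ⟨l, rfl⟩ : ∃ k, l = k + 2 := ⟨l - 2, by have := (List.mem_range'_1.1 hl).1; omega⟩
      rfl
    rw [doubleG, genG, genG, h1]
    change _ = _ * factor _ (bar (bar (va 1)))
    rw [bar_bar (constantCoeff_va 1)]
    simp only [mul_assoc]
    rw [h2]
    rfl
  | C =>
    refine ⟨1, fun N => ?_⟩
    have h1 : genBoldF .C (gen .C) n (N + 1) (fun i => reflVar .C 0 (.x i))
        = genBoldF .C (gen .C) n N vx * genF .C (gen .C) n (va 1) := by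
      rw [genBoldF_succ', ← (hF N (va 1)).eq]
      exact congrArg _ (genBoldF_congr _ _ _ _ fun i => rfl)
    have hc := commute_tail (A := Ser) (z := factor (gen .C 0) (oplus (va 1) (va 1)))
      (g := gen .C) (i := 2) (fun k hk => (Commute.one_left _).add_left
        ((gen_zero_commute_BC (Or.inr rfl) hk).smul_left _)) n (n - 1) va
    have h2 : genF .C (gen .C) n (va 1) * genGA (gen .C) n (fun i => reflVar .C 0 (.a i))
        = genGA (gen .C) n va * factor (gen .C 0) (oplus (va 1) (va 1)) := by
      rw [genGA_split_one _ (by omega), genGA_split_one _ (by omega), mul_assoc, ← hc.eq,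
        ← mul_assoc, ← mul_assoc, genF, pow_two, factor_mul_factor (gen_sq .C 0)]
      change desc (gen .C) n 1 (va 1) * factor (gen .C 0) (oplus (va 1) (va 1)) *
        asc (gen .C) n 1 (va 1) * desc (gen .C) n 1 (bar (va 1)) * _ = _
      rw [hA.sandwich_mul_desc (ha 1)]
      congr 2
      refine List.map_congr_left fun l hl => ?_
      obtain ⟨l, rfl⟩ : ∃ k, l = k + 2 := ⟨l - 2, by have := (List.mem_range'_1.1 hl).1; omega⟩
      rfl
    rw [doubleG, genG, genG, h1]
    change _ = _ * factor _ (bar (oplus (bar (va 1)) (bar (va 1))))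
    rw [bar_oplus_bar]
    simp only [mul_assoc]
    rw [h2]
    rfl
  | D =>
    refine ⟨2, fun N => ?_⟩
    have h1 : genBoldF .D (gen .D) n (N + 2) (fun i => reflVar .D 0 (.x i))
        = genBoldF .D (gen .D) n N vx *
          (genF .D (gen .D) n (va 1) * genF .D (gen .D) n (va 2)) := by
      rw [genBoldF_succ', genBoldF_succ', ← ((hF N (va 1)).mul_left (hF N (va 2))).eq, mul_assoc]
      exact congrArg _ (congrArg _ (genBoldF_congr _ _ _ _ fun i => rfl))
    have hc := commute_tail (A := Ser) (z := factor (gen .D 0) (oplus (va 1) (va 2)))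
      (g := gen .D) (i := 3) (fun k hk => (Commute.one_left _).add_left
        ((gen_zero_commute (by simp) hk).smul_left _)) n (n - 2) va
    have h2 : genF .D (gen .D) n (va 1) * genF .D (gen .D) n (va 2) *
          genGA (gen .D) n (fun i => reflVar .D 0 (.a i))
        = genGA (gen .D) n va * factor (gen .D 0) (oplus (va 1) (va 2)) := by
      rw [genGA_split_two _ hn, genGA_split_two _ hn, mul_assoc (desc _ _ _ (va 1) * _), ← hc.eq,
        ← mul_assoc, ← mul_assoc (desc _ _ _ (va 1) * _), genF, genF]
      rw [oplus, ← typeD_exchange hA gen_forkChain gen_one_commute_zero (ha 1) (ha 2) rfl hn]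
      congr 2
      refine List.map_congr_left fun l hl => ?_
      obtain ⟨l, rfl⟩ : ∃ k, l = k + 3 := ⟨l - 3, by have := (List.mem_range'_1.1 hl).1; omega⟩
      rfl
    rw [doubleG, genG, genG, h1]
    change _ = _ * factor _ (bar (oplus (bar (va 1)) (bar (va 2))))
    rw [bar_oplus_bar]
    simp only [mul_assoc] at h2 ⊢
    rw [h2]
    rfl

/-- The reflection `s_i^{(a)}` multiplies `G_n^X(a, b; x)` on the right by `h_i(ᾱ_i(a))`. -/
theorem genG_reflection (X : ClassicalType) {j n : ℕ} (hn : 2 ≤ n) (hj : label X j < n) :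
    ∃ k, ∀ N, genG X (gen X) n (N + k) (fun i => reflVar X (label X j) (.a i))
        (fun i => reflVar X (label X j) (.b i)) (fun i => reflVar X (label X j) (.x i))
      = doubleG X n N * factor (gen X (label X j)) (bar (root X (label X j))) := by
  rcases h : label X j with _ | i
  · exact genG_special_reflection (by rintro rfl; simp [label] at h) hn
  · refine ⟨0, fun N => ?_⟩
    have hv : ∀ t, reflVar X (i + 1) (.a t) = va (Equiv.swap (i + 1) (i + 2) t) := fun t => by
      cases X <;> rfl
    have hb : ∀ t, reflVar X (i + 1) (.b t) = vb t := fun t => by cases X <;> rfl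
    have hx : ∀ t, reflVar X (i + 1) (.x t) = vx t := fun t => by cases X <;> rfl
    have hr : root X (i + 1) = oplus (va (i + 1)) (bar (va (i + 2))) := by cases X <;> rfl
    simp only [hv, hb, hx, hr]
    rw [genG, (gen_isTypeA X).genGA_swap (by omega) (by omega) va (va_succ_eq i), ← mul_assoc]
    rfl

variable {X : ClassicalType}

/-- The action of a simple reflection on the double Grothendieck polynomials:
`s_i^{(a)} 𝒢 = 𝒢 · (1 + ᾱ_i(a) u_i)` for `𝒢 = ∑ 𝒢_w u_w`. -/
theorem reflHom_groth (j : ℕ) (w : Weyl X) :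
    reflHom X (label X j) (groth X w) = groth X w +
      bar (root X (label X j)) * rightMul (weylSystem X) beta j (groth X) w := by
  obtain ⟨m, hw, hm⟩ := ((eventually_mem_parabolic w).and
    (eventually_ge_atTop (j + 2))).exists
  have hj : label X j < m := (label_le X j).trans_lt (by omega)
  have hws : w * (weylSystem X).simple j ∈ parabolic X m := mul_mem hw (simple_mem_parabolic hj)
  have hm2 : 2 ≤ m := by omega
  obtain ⟨k, hk⟩ := genG_reflection X hm2 hj
  have h1 := ((isLimit_doubleG hm2 hw).subst (hasSubst_reflVar X (label X j))).shift k
  have hright : IsLimit (fun N => rightMul (weylSystem X) beta j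
      (fun v => coeffU (weylSystem X) beta v (doubleG X m N)) w)
      (rightMul (weylSystem X) beta j (groth X) w) := by
    unfold rightMul
    split_ifs
    · exact (isLimit_doubleG hm2 hws).add ((isLimit_const beta).mul (isLimit_doubleG hm2 hw))
    · exact isLimit_const 0
  have h2 := (isLimit_doubleG hm2 hw).add
    ((isLimit_const (bar (root X (label X j)))).mul hright)
  refine h1.unique (h2.congr (Eventually.of_forall fun N => ?_))
  change _ = reflHom X (label X j) (coeffU (weylSystem X) beta w (genG X (gen X) m (N + k) va vb vx))
  rw [map_coeffU_genG (reflHom_beta X _)]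
  change _ = coeffU (weylSystem X) beta w (genG X (gen X) m (N + k)
    (fun i => reflHom X (label X j) (MvPowerSeries.X (Var.a i)))
    (fun i => reflHom X (label X j) (MvPowerSeries.X (Var.b i)))
    (fun i => reflHom X (label X j) (MvPowerSeries.X (Var.x i))))
  simp only [reflHom_X]
  rw [hk, factor, mul_add, mul_one, mul_smul_comm, coeffU_add, coeffU_smul, gen, node_label,
    coeffU_mul_u]

/-- The numerator of the divided difference of a coefficient of `𝒢 · u_ω`. -/
theorem piNumerator_rightMulWord (ω : List ℕ) (j : ℕ) (w : Weyl X) :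
    piNumerator X j (rightMulWord (weylSystem X) beta ω (groth X) w) = root X (label X j) *
      (rightMulWord (weylSystem X) beta (j :: ω) (groth X) w
        - beta * rightMulWord (weylSystem X) beta ω (groth X) w) := by
  have h1 : refl X (label X j) (rightMulWord (weylSystem X) beta ω (groth X) w) =
      rightMulWord (weylSystem X) beta ω (groth X) w + bar (root X (label X j)) *
        rightMulWord (weylSystem X) beta (j :: ω) (groth X) w := by
    rw [← reflHom_apply, map_rightMulWord _ _ (reflHom_beta X _)]
    have e : (fun v => reflHom X (label X j) (groth X v)) = groth X +
        bar (root X (label X j)) • rightMul (weylSystem X) beta j (groth X) :=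
      funext fun v => reflHom_groth j v
    rw [e, rightMulWord_add_smul, rightMulWord_cons]
    rfl
  have h2 := oplus_bar (constantCoeff_root X j)
  rw [piNumerator, h1]
  linear_combination (-rightMulWord (weylSystem X) beta (j :: ω) (groth X) w) * h2

/-- The operators `ψ_i^{(a)}` act on `𝒢 = ∑ 𝒢_w u_w` by right multiplication by `u_i`. -/
theorem psiWord_groth (ω : List ℕ) (w : Weyl X) :
    psiWord X ω (groth X w) = rightMulWord (weylSystem X) beta ω (groth X) w := by
  induction ω with
  | nil => rfl
  | cons j ω ih =>
    change psiOp X j (psiWord X ω (groth X w)) = _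
    have h := piNumerator_rightMulWord ω j w
    have hd : root X (label X j) ∣ piNumerator X j
        (rightMulWord (weylSystem X) beta ω (groth X) w) := ⟨_, h⟩
    have hq : piOp X j (rightMulWord (weylSystem X) beta ω (groth X) w) =
        rightMulWord (weylSystem X) beta (j :: ω) (groth X) w
          - beta * rightMulWord (weylSystem X) beta ω (groth X) w := by
      rw [piOp, exactQuotient, dif_pos hd]
      exact mul_left_cancel₀ (root_ne_zero X j) (hd.choose_spec.symm.trans h)
    rw [ih, psiOp, hq, sub_add_cancel]

/-- A reduced word of `v`, the one used in the definition of `ψ_v`. -/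
noncomputable def redWord (v : Weyl X) : List ℕ := ((weylSystem X).exists_isReduced v).choose

theorem redWord_isReduced (v : Weyl X) : (weylSystem X).IsReduced (redWord v) :=
  ((weylSystem X).exists_isReduced v).choose_spec.1

theorem wordProd_redWord (v : Weyl X) : (weylSystem X).wordProd (redWord v) = v :=
  ((weylSystem X).exists_isReduced v).choose_spec.2.symm

theorem psi_groth (v w : Weyl X) :
    psi X v (groth X w) = rightMulWord (weylSystem X) beta (redWord v) (groth X) w :=
  psiWord_groth (redWord v) w

end Reflection

/-! ### Change of parameters -/

section ChangeOfParameters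

open MvPowerSeries Filter

variable {X : ClassicalType}

theorem hasSubst_evalAt {p q y : ℕ → Ser} (hp : ∃ s : ℕ → Var, ∀ i, (s i).index = i ∧
      MvPowerSeries.X (s i) ∣ p i)
    (hq : ∃ s : ℕ → Var, ∀ i, (s i).index = i ∧ MvPowerSeries.X (s i) ∣ q i)
    (hy : ∃ s : ℕ → Var, ∀ i, (s i).index = i ∧ MvPowerSeries.X (s i) ∣ y i) :
    HasSubst (fun
      | .a i => p i
      | .b i => q i
      | .c i => vc i
      | .x i => y i : Var → Ser) := by
  obtain ⟨s, hs⟩ := hp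
  obtain ⟨s', hs'⟩ := hq
  obtain ⟨s'', hs''⟩ := hy
  refine hasSubst_of_X_dvd fun t => ?_
  rcases t with i | i | i | i
  · exact ⟨s i, by rw [(hs i).1]; simp [Var.index], (hs i).2⟩
  · exact ⟨s' i, by rw [(hs' i).1]; simp [Var.index], (hs' i).2⟩
  · exact ⟨Var.c i, by simp, dvd_rfl⟩
  · exact ⟨s'' i, by rw [(hs'' i).1]; simp [Var.index], (hs'' i).2⟩

theorem hasSubst_adjoint : HasSubst (fun
      | .a i => bar (vc i)
      | .b i => vb i
      | .c i => vc i
      | .x i => (0 : ℕ → Ser) i : Var → Ser) :=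
  hasSubst_evalAt ⟨Var.c, fun _ => ⟨rfl, X_dvd_bar dvd_rfl⟩⟩ ⟨Var.b, fun _ => ⟨rfl, dvd_rfl⟩⟩
    ⟨Var.x, fun _ => ⟨rfl, dvd_zero _⟩⟩

theorem hasSubst_changeParameter : HasSubst (fun
      | .a i => va i
      | .b i => vc i
      | .c i => vc i
      | .x i => vx i : Var → Ser) :=
  hasSubst_evalAt ⟨Var.a, fun _ => ⟨rfl, dvd_rfl⟩⟩ ⟨Var.c, fun _ => ⟨rfl, dvd_rfl⟩⟩
    ⟨Var.x, fun _ => ⟨rfl, dvd_rfl⟩⟩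

/-- `G_n^X(a, b; x) = G_n^X(c̄, b; 0) G_n^X(a, c; x)`. -/
theorem doubleG_eq_mul (n N : ℕ) : doubleG X n N =
    genG X (gen X) n N (fun i => bar (vc i)) vb 0 * genG X (gen X) n N va vc vx := by
  have h : genGA (gen X) n (fun i => bar (vc i)) * genGAInv (gen X) n vc = 1 :=
    (gen_isTypeA X).genGA_mul_genGAInv n fun i => by
      linear_combination oplus_bar (constantCoeff_vc i)
  rw [doubleG, genG, genG, genG, genBoldF_zero, mul_one]
  simp only [mul_assoc]
  rw [← mul_assoc (genGA (gen X) n _) (genGAInv (gen X) n vc), h, one_mul]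

/-- `𝒢_w^X(c̄, b; 0)` is a coefficient of `G_m^X(c̄, b; 0)`. -/
theorem evalAt_adjoint_groth {m : ℕ} (hm : 2 ≤ m) {w : Weyl X} (hw : w ∈ parabolic X m) (N : ℕ) :
    substHom hasSubst_adjoint (groth X w)
      = coeffU (weylSystem X) beta w (genG X (gen X) m N (fun i => bar (vc i)) vb 0) := by
  have h := (isLimit_doubleG hm hw).subst hasSubst_adjoint
  refine h.unique ((isLimit_const _).congr (Eventually.of_forall fun N' => ?_))
  change _ = substHom hasSubst_adjoint (coeffU (weylSystem X) beta w
    (genG X (gen X) m N' (fun i => MvPowerSeries.X (Var.a i)) (fun i => MvPowerSeries.X (Var.b i))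
      (fun i => MvPowerSeries.X (Var.x i))))
  rw [map_coeffU_genG (substHom_beta _)]
  simp only [substHom_X]
  change _ = coeffU (weylSystem X) beta w (genG X (gen X) m N' (fun i => bar (vc i)) vb 0)
  rw [genG, genG, genBoldF_zero, genBoldF_zero]

theorem isLimit_changeParameter {m : ℕ} (hm : 2 ≤ m) {w : Weyl X} (hw : w ∈ parabolic X m) :
    IsLimit (fun N => coeffU (weylSystem X) beta w (genG X (gen X) m N va vc vx))
      (substHom hasSubst_changeParameter (groth X w)) := by
  refine ((isLimit_doubleG hm hw).subst hasSubst_changeParameter).congr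
    (Eventually.of_forall fun N => ?_)
  change substHom hasSubst_changeParameter (coeffU (weylSystem X) beta w
    (genG X (gen X) m N (fun i => MvPowerSeries.X (Var.a i)) (fun i => MvPowerSeries.X (Var.b i))
      (fun i => MvPowerSeries.X (Var.x i)))) = _
  rw [map_coeffU_genG (substHom_beta _)]
  simp only [substHom_X]

/-- The change of parameter formula as a sum over the second factors `v` of the factorizations
`w = u v`. -/
theorem groth_eq_sum (w : Weyl X) (T : Finset (Weyl X))
    (hT : ∀ v, BruhatLE (weylSystem X) (w * v⁻¹) w → v ∈ T) :
    groth X w = ∑ v ∈ T, substHom hasSubst_adjoint (psi X v (groth X w)) *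
      substHom hasSubst_changeParameter (groth X v) := by
  classical
  choose S hS using fun v : Weyl X =>
    rightMulWord_finite_dependence (A := Ser) (weylSystem X) beta (redWord v) w
  -- `m` is so large that the parabolic subgroup contains all elements whose coefficients matter
  obtain ⟨m, hw, hm, hmT, hmS⟩ := ((eventually_mem_parabolic w).and
    ((eventually_ge_atTop 2).and (((Filter.eventually_all_finset T).2 fun v _ =>
      eventually_mem_parabolic v).and ((Filter.eventually_all_finset T).2 fun v _ =>
        (Filter.eventually_all_finset (S v)).2 fun p _ => eventually_mem_parabolic p)))).exists
  have hsum : IsLimit (fun N => ∑ v ∈ T, substHom hasSubst_adjoint (psi X v (groth X w)) *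
      coeffU (weylSystem X) beta v (genG X (gen X) m N va vc vx))
      (∑ v ∈ T, substHom hasSubst_adjoint (psi X v (groth X w)) *
        substHom hasSubst_changeParameter (groth X v)) :=
    IsLimit.sum fun v hv => (isLimit_const _).mul (isLimit_changeParameter hm (hmT v hv))
  refine (isLimit_doubleG hm hw).unique (hsum.congr (Eventually.of_forall fun N => ?_))
  rw [doubleG_eq_mul, coeffU_mul (weylSystem X) beta _ _ w redWord redWord_isReduced
    wordProd_redWord T hT]
  refine Finset.sum_congr rfl fun v hv => ?_
  rw [psi_groth, map_rightMulWord _ _ (substHom_beta _),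
    hS v _ _ fun p hp => evalAt_adjoint_groth hm (hmS v hv p hp) N]

end ChangeOfParameters

end KGroth

theorem theorem3 (X : KGroth.ClassicalType) (w : KGroth.Weyl X) :
    -- the limit that defines `𝒢_w^X(a, b; x)` exists
    KGroth.IsLimit (fun n => KGroth.grothN X n w) (KGroth.groth X w) ∧
    -- all divided differences of `𝒢_w^X(a, b; x)` exist
    (∀ (ω : List ℕ) (j : ℕ), KGroth.root X (KGroth.label X j) ∣
      KGroth.piNumerator X j (KGroth.psiWord X ω (KGroth.groth X w))) ∧
    -- `ψ_v^{(a)}` does not depend on the reduced word of `v`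
    (∀ ω : List ℕ, (KGroth.weylSystem X).IsReduced ω →
      KGroth.psiWord X ω (KGroth.groth X w) =
        KGroth.psi X ((KGroth.weylSystem X).wordProd ω) (KGroth.groth X w)) ∧
    -- the sum is finite
    {p : KGroth.Weyl X × KGroth.Weyl X |
      p.1 * p.2 = w ∧ KGroth.BruhatLE (KGroth.weylSystem X) p.1 w}.Finite ∧
    -- the change of parameter formula
    KGroth.groth X w =
      ∑ᶠ p ∈ {p : KGroth.Weyl X × KGroth.Weyl X |
          p.1 * p.2 = w ∧ KGroth.BruhatLE (KGroth.weylSystem X) p.1 w},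
        KGroth.evalAt (fun i => KGroth.bar (KGroth.vc i)) KGroth.vb 0
            (KGroth.relAdjoint X p.1 w) *
          KGroth.evalAt KGroth.va KGroth.vc KGroth.vx (KGroth.groth X p.2) := by
  classical
  open KGroth in
  have hfin : {p : Weyl X × Weyl X | p.1 * p.2 = w ∧ BruhatLE (weylSystem X) p.1 w}.Finite := by
    refine ((bruhatLE_finite (weylSystem X) w).image fun p => (p, p⁻¹ * w)).subset ?_
    rintro ⟨p, v⟩ ⟨h, hp⟩
    exact ⟨p, hp, by simp [← show p * v = w from h]⟩
  refine ⟨isLimit_groth w, fun ω j => ?_, fun ω hω => ?_, hfin, ?_⟩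
  · rw [psiWord_groth, piNumerator_rightMulWord]
    exact dvd_mul_right _ _
  · rw [psiWord_groth, psi_groth, rightMulWord_eq_of_wordProd_eq (weylSystem X) beta hω
      (redWord_isReduced _) (wordProd_redWord _).symm]
  · rw [finsum_mem_eq_finite_toFinset_sum _ hfin]
    have hinj : Set.InjOn (Prod.snd : Weyl X × Weyl X → Weyl X) hfin.toFinset := by
      rintro ⟨p, v⟩ hp ⟨p', v'⟩ hp' (rfl : v = v')
      simp only [Set.Finite.coe_toFinset, Set.mem_ofPred_eq] at hp hp'
      rw [mul_right_cancel (hp.1.trans hp'.1.symm)]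
    rw [groth_eq_sum w (hfin.toFinset.image Prod.snd), Finset.sum_image hinj]
    · refine Finset.sum_congr rfl fun p hp => ?_
      rw [Set.Finite.mem_toFinset] at hp
      have e : p.1⁻¹ * w = p.2 := by rw [← hp.1]; group
      rw [relAdjoint, e, substHom_apply, substHom_apply]
      rfl
    · intro v hv
      exact Finset.mem_image.2 ⟨(w * v⁻¹, v),
        hfin.mem_toFinset.2 ⟨by group, hv⟩, rfl⟩
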